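/- Let $\mathbb{T}^2=(\mathbb{R}/2\pi\mathbb{Z})^2$, $\widehat u(k)=\frac1{(2\pi)^2}\int_{\mathbb{T}^2}u(x)e^{-ik\cdot x}\,dx$ for $k\in\mathbb{Z}^2$, and for $s\ge 0$ let $A^s$ be the space of real $u\in L^1(\mathbb{T}^2)$ with $\|u\|_{A^s}=\sum_{k\in\mathbb{Z}^2}|k|^s|\widehat u(k)|<\infty$ (with $0^0=1$). Let $K_0\ge 0$, $K_1\ge 0$, $K_2>0$, and consider the problem $$\partial_t u=K_0\Delta u+2K_1\det D^2u-K_2\Delta^2u\quad\text{in }(0,T)\times\mathbb{T}^2,\qquad u(0,x)=u_0(x)\quad\text{in }\mathbb{T}^2 .$$ A function $u$ is a weak solution on $(0,T)$ if $u\in L^\infty((0,T)\times\mathbb{T}^2)\cap L^2(0,T;W^{2,4}(\mathbb{T}^2))$ and $$\int_{\mathbb{T}^2}u_0\varphi(0)\,dx+\iint_{\mathbb{T}^2\times(0,T)}\big(u\,\partial_t\varphi+K_0u\Delta\varphi+2K_1\varphi\det D^2u-K_2u\Delta^2\varphi\big)\,dx\,dt=0,$$ all the integrals being well defined, for every $\varphi\in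 W^{1,1}(0,T;L^1(\mathbb{T}^2))\cap L^1(0,T;W^{4,1}(\mathbb{T}^2))\cap L^2(0,T;H^2(\mathbb{T}^2))$ with $\varphi(T)=0$. **Theorem.** Let $u_0\in A^0$ have zero mean and satisfy $K_2-2K_1\|u_0\|_{A^0}>0$. Then there exists at least one global weak solution, that is, a function $u$ on $(0,\infty)\times\mathbb{T}^2$ which for every $T>0$ is a weak solution on $(0,T)$, and it satisfies $$u\in L^\infty(0,T;A^0)\cap L^1(0,T;A^4)\qquad\text{for all }T>0 .$$ Furthermore, for all $t\ge0$, $$\|u(t)\|_{A^0}\le e^{-(K_2-2K_1\|u_0\|_{A^0})t}\,\|u_0\|_{A^0}.$$ -/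

import Mathlib

open MeasureTheory Set
open scoped ENNReal Real

noncomputable section

namespace HessianFlow

instance factTwoPiPos : Fact (0 < 2 * π) := ⟨Real.two_pi_pos⟩

/-- The two-dimensional torus `𝕋² = (ℝ / 2πℤ)²`; its `volume` has total mass `4π²`. -/
abbrev Torus : Type := Fin 2 → AddCircle (2 * π)

/-! ### Fourier coefficients and Wiener spaces -/

/-- The character `x ↦ e^{i k·x}`. -/
def character (k : Fin 2 → ℤ) (x : Torus) : ℂ := ∏ j, fourier (k j) (x j)

/-- `û(k) = (2π)⁻² ∫ u(x) e^{-i k·x} dx`. -/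
def coeff (f : Torus → ℝ) (k : Fin 2 → ℤ) : ℂ :=
  (1 / (2 * (π : ℂ)) ^ 2) * ∫ x, (f x : ℂ) * character (-k) x

/-- The Euclidean length `|k|`. -/
def freq (k : Fin 2 → ℤ) : ℝ := √(∑ j, (k j : ℝ) ^ 2)

/-- `‖f‖_{A^s} = ∑ₖ |k|^s |f̂(k)|`, in `[0, ∞]`. For `s = 0` the mode `k = 0` has weight one. -/
def wienerNorm (s : ℝ) (f : Torus → ℝ) : ℝ≥0∞ :=
  ∑' k : Fin 2 → ℤ, ENNReal.ofReal (freq k ^ s) * ‖coeff f k‖ₑ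

/-- `f ∈ A^s`. -/
def MemWiener (s : ℝ) (f : Torus → ℝ) : Prop :=
  Integrable f ∧ wienerNorm s f < ∞

/-! ### Weak derivatives on the torus -/

/-- The classical partial derivative `∂_j ζ` on the torus. -/
def partialDeriv (j : Fin 2) (ζ : Torus → ℝ) (x : Torus) : ℝ :=
  deriv (fun s : ℝ => ζ (x + Pi.single j (s : AddCircle (2 * π)))) 0

/-- `D^α ζ = ∂₀^{α₀} ∂₁^{α₁} ζ`, classically. -/
def classicalDeriv (α : Fin 2 → ℕ) (ζ : Torus → ℝ) : Torus → ℝ :=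
  (partialDeriv 0)^[α 0] ((partialDeriv 1)^[α 1] ζ)

/-- `ζ ∈ C^∞(𝕋²)`: the lift of `ζ` to `ℝ²` is smooth. -/
def IsSmooth (ζ : Torus → ℝ) : Prop :=
  ContDiff ℝ (⊤ : ℕ∞) (fun y : Fin 2 → ℝ => ζ (fun j => (y j : AddCircle (2 * π))))

/-- `v ∈ L¹(𝕋²)` is the weak derivative `D^α f` of `f ∈ L¹(𝕋²)`. -/
def IsWeakDeriv (α : Fin 2 → ℕ) (f v : Torus → ℝ) : Prop :=
  Integrable f ∧ Integrable v ∧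
    ∀ ζ : Torus → ℝ, IsSmooth ζ →
      ∫ x, f x * classicalDeriv α ζ x = (-1) ^ (α 0 + α 1) * ∫ x, v x * ζ x

/-! ### Functions of time and space -/

/-- Lebesgue measure on the time interval `(0,T)`. -/
abbrev timeMeasure (T : ℝ) : Measure ℝ := volume.restrict (Ioo 0 T)

/-- Lebesgue measure on `(0,T) × 𝕋²`. -/
abbrev slab (T : ℝ) : Measure (ℝ × Torus) := (timeMeasure T).prod volume

/-- `u ∈ L^p(0,T; A^s)`. -/
def MemLpWiener (T : ℝ) (p : ℝ≥0∞) (s : ℝ) (u : ℝ → Torus → ℝ) : Prop :=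
  AEStronglyMeasurable (Function.uncurry u) (slab T) ∧
  (∀ᵐ t ∂(timeMeasure T), MemWiener s (u t)) ∧
  AEMeasurable (fun t => wienerNorm s (u t)) (timeMeasure T) ∧
  eLpNorm (fun t => wienerNorm s (u t)) p (timeMeasure T) < ∞

/-- `u ∈ L^p(0,T; W^{m,q}(𝕋²))`, with weak spatial derivatives `D^α u = D α` for `|α| ≤ m`. -/
def MemLpSobolevWith (T : ℝ) (p : ℝ≥0∞) (m : ℕ) (q : ℝ≥0∞) (u : ℝ → Torus → ℝ)
    (D : (Fin 2 → ℕ) → ℝ → Torus → ℝ) : Prop :=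
  AEStronglyMeasurable (Function.uncurry u) (slab T) ∧
  ∀ α : Fin 2 → ℕ, α 0 + α 1 ≤ m →
    AEStronglyMeasurable (Function.uncurry (D α)) (slab T) ∧
    (∀ᵐ t ∂(timeMeasure T), IsWeakDeriv α (u t) (D α t)) ∧
    eLpNorm (fun t => eLpNorm (D α t) q volume) p (timeMeasure T) < ∞

/-- `φ ∈ W^{1,1}(0,T; L¹(𝕋²))` with time derivative `φt`: both lie in `L¹(0,T; L¹(𝕋²))` and, `φ`
being the absolutely continuous representative, `φ(t) = φ(0) + ∫₀ᵗ φt(s) ds` in `L¹(𝕋²)` for every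
`t ∈ [0,T]`. In particular `φ(0)` and `φ(T)` are the traces of `φ`. -/
def MemW11With (T : ℝ) (φ φt : ℝ → Torus → ℝ) : Prop :=
  Integrable (Function.uncurry φ) (slab T) ∧
  Integrable (Function.uncurry φt) (slab T) ∧
  Integrable (φ 0) ∧
  ∀ t ∈ Icc 0 T, φ t =ᵐ[volume] fun x => φ 0 x + ∫ s in (0 : ℝ)..t, φt s x

/-- The test functions on `[0,T]`,
`φ ∈ W^{1,1}(0,T; L¹) ∩ L¹(0,T; W^{4,1}) ∩ L²(0,T; H²)` with `φ(T) = 0`,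
together with their time derivative `φt` and their spatial derivatives `D α`. -/
structure IsTestFunction (T : ℝ) (φ φt : ℝ → Torus → ℝ)
    (D : (Fin 2 → ℕ) → ℝ → Torus → ℝ) : Prop where
  memW11 : MemW11With T φ φt
  memL1W41 : MemLpSobolevWith T 1 4 1 φ D
  memL2H2 : MemLpSobolevWith T 2 2 2 φ D
  final : φ T =ᵐ[volume] 0

/-! The differential operators of the equation, from the family `D α = D^α u`. -/

/-- `Δu`. -/
def laplacian (D : (Fin 2 → ℕ) → ℝ → Torus → ℝ) (t : ℝ) (x : Torus) : ℝ :=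
  D ![2, 0] t x + D ![0, 2] t x

/-- `Δ²u`. -/
def bilaplacian (D : (Fin 2 → ℕ) → ℝ → Torus → ℝ) (t : ℝ) (x : Torus) : ℝ :=
  D ![4, 0] t x + 2 * D ![2, 2] t x + D ![0, 4] t x

/-- `det D²u`. -/
def hessianDet (D : (Fin 2 → ℕ) → ℝ → Torus → ℝ) (t : ℝ) (x : Torus) : ℝ :=
  D ![2, 0] t x * D ![0, 2] t x - D ![1, 1] t x ^ 2

/-- The space-time integrand
`u ∂ₜφ + K₀ u Δφ + 2 K₁ φ det D²u - K₂ u Δ²φ` of the weak formulation. -/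
def weakIntegrand (K₀ K₁ K₂ : ℝ) (u : ℝ → Torus → ℝ) (Du : (Fin 2 → ℕ) → ℝ → Torus → ℝ)
    (φ φt : ℝ → Torus → ℝ) (Dφ : (Fin 2 → ℕ) → ℝ → Torus → ℝ) (z : ℝ × Torus) : ℝ :=
  u z.1 z.2 * φt z.1 z.2 + K₀ * u z.1 z.2 * laplacian Dφ z.1 z.2
    + 2 * K₁ * φ z.1 z.2 * hessianDet Du z.1 z.2
    - K₂ * u z.1 z.2 * bilaplacian Dφ z.1 z.2

/-- `u` is a weak solution on `(0,T) × 𝕋²` of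
`∂ₜu = K₀ Δu + 2 K₁ det D²u - K₂ Δ²u`, `u(0) = u₀`. -/
def IsWeakSolution (K₀ K₁ K₂ : ℝ) (u₀ : Torus → ℝ) (T : ℝ) (u : ℝ → Torus → ℝ) : Prop :=
  MemLp (Function.uncurry u) ∞ (slab T) ∧
  ∃ Du : (Fin 2 → ℕ) → ℝ → Torus → ℝ, MemLpSobolevWith T 2 2 4 u Du ∧
    ∀ (φ φt : ℝ → Torus → ℝ) (Dφ : (Fin 2 → ℕ) → ℝ → Torus → ℝ), IsTestFunction T φ φt Dφ →
      Integrable (fun x => u₀ x * φ 0 x) ∧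
      Integrable (weakIntegrand K₀ K₁ K₂ u Du φ φt Dφ) (slab T) ∧
      (∫ x, u₀ x * φ 0 x) + ∫ z, weakIntegrand K₀ K₁ K₂ u Du φ φt Dφ z ∂(slab T) = 0

end HessianFlow

end

noncomputable section

namespace HessianFlow

/-! In Fourier variables the equation is the system `cₖ' = -(K₀|k|² + K₂|k|⁴) cₖ + ∑ⱼ m(j, k-j) cⱼ
c_{k-j}` with `m(j,l) = 2K₁ j₀l₁(j₀l₁ - j₁l₀)`. Two facts about the kernel matter: `|m(j,l)| ≤
2K₁|j|²|l|²` (`abs_detKernel_le`), and `m(j,-j) = 0`, so the mean stays zero and only modes with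
`|k| ≥ 1` are active. Put `E = ∑|cₖ|` and `D = ∑|k|⁴|cₖ|`. By Cauchy–Schwarz `(∑|k|²|cₖ|)² ≤ E D`,
hence formally `E' ≤ -(K₂ - 2K₁E) D`. The smallness assumption makes the bracket positive and the
inequality keeps it so; `D ≥ E` then gives exponential decay, and integration in time gives the
`L¹(A⁴)` bound.

Rigorously, Picard iterates truncated to finitely many modes are compared with a majorant: the same
iteration run with `|m|` and with the absolute values of the data. Majorants increase along the
iteration, and their increments dominate those of the iterates (`norm_picard_succ_sub_le`).
Monotonicity also closes the energy estimate, since the nonlinearity at step `n+1` is built from the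
smaller step `n` (`sum_quadratic_majorant_le`); so `energy_le` and `integral_dissipation_le` are
uniform in `n`. Bounded monotone majorants converge, the increments of the iterates are summable,
and no compactness is needed; `picardLim_eq_integral` passes to the limit in the integrated system.

Back in physical space, at almost every time `det D²u` is an absolutely convergent Fourier series
(`hessianDet_eq_series`). The weak formulation is verified mode by mode, integrating `cₖ` by parts
against the Fourier coefficient of the test function (`integral_modeIntegrand`), and the modes are
summed by dominated convergence (`hasSum_integral_modeIntegrand`). Uniqueness of Fourier
coefficients (`ae_eq_series_coeff`) identifies the initial datum. -/

/-! ### Duhamel's formula for a scalar linear equation -/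

/-- The solution of `y' = -μ y + f`, `y 0 = x`. -/
def duhamel {E : Type*} [NormedAddCommGroup E] [NormedSpace ℝ E] (μ : ℝ) (x : E) (f : ℝ → E)
    (t : ℝ) : E :=
  Real.exp (-μ * t) • (x + ∫ s in (0 : ℝ)..t, Real.exp (μ * s) • f s)

section Duhamel

variable {E : Type*} [NormedAddCommGroup E] [NormedSpace ℝ E]

theorem duhamel_zero (μ : ℝ) (x : E) (f : ℝ → E) : duhamel μ x f 0 = x := by
  simp [duhamel]

theorem hasDerivAt_duhamel [CompleteSpace E] (μ : ℝ) (x : E) {f : ℝ → E} (hf : Continuous f)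
    (t : ℝ) : HasDerivAt (duhamel μ x f) (-μ • duhamel μ x f t + f t) t := by
  have h1 : HasDerivAt (fun t => Real.exp (-μ * t)) (Real.exp (-μ * t) * (-μ)) t := by
    simpa using ((hasDerivAt_id t).const_mul (-μ)).exp
  have hc : Continuous fun s => Real.exp (μ * s) • f s := by fun_prop
  have h2 : HasDerivAt (fun t => x + ∫ s in (0 : ℝ)..t, Real.exp (μ * s) • f s)
      (Real.exp (μ * t) • f t) t :=
    (intervalIntegral.integral_hasDerivAt_right (hc.intervalIntegrable _ _)
      hc.stronglyMeasurable.stronglyMeasurableAtFilter hc.continuousAt).const_add x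
  refine (h1.smul h2).congr_deriv ?_
  have : Real.exp (-μ * t) * Real.exp (μ * t) = 1 := by
    rw [← Real.exp_add]; simp
  rw [smul_smul, this, one_smul, duhamel, smul_smul, mul_comm (-μ) (Real.exp _), add_comm]

theorem continuous_duhamel [CompleteSpace E] (μ : ℝ) (x : E) {f : ℝ → E} (hf : Continuous f) :
    Continuous (duhamel μ x f) :=
  continuous_iff_continuousAt.2 fun t => (hasDerivAt_duhamel μ x hf t).continuousAt

/-- The kernel `exp(-μ(t-s))` is positive, so bounds on the datum and on the forcing pass to the
solution. This comparison principle drives every majorant estimate. -/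
theorem norm_duhamel_le {μ : ℝ} {x : E} {y : ℝ} (hxy : ‖x‖ ≤ y) {f : ℝ → E} {b : ℝ → ℝ}
    (hb : Continuous b) {t : ℝ} (ht : 0 ≤ t) (h : ∀ s, 0 ≤ s → ‖f s‖ ≤ b s) :
    ‖duhamel μ x f t‖ ≤ duhamel μ y b t := by
  rw [duhamel, duhamel, norm_smul, Real.norm_of_nonneg (Real.exp_pos _).le, smul_eq_mul]
  refine mul_le_mul_of_nonneg_left ?_ (Real.exp_pos _).le
  refine (norm_add_le _ _).trans (add_le_add hxy ?_)
  refine intervalIntegral.norm_integral_le_of_norm_le ht (.of_forall fun s hs => ?_)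
    (Continuous.intervalIntegrable (by fun_prop) _ _)
  rw [norm_smul, Real.norm_of_nonneg (Real.exp_pos _).le, smul_eq_mul]
  exact mul_le_mul_of_nonneg_left (h s hs.1.le) (Real.exp_pos _).le

theorem duhamel_sub (μ : ℝ) (x y : E) {f g : ℝ → E} (hf : Continuous f) (hg : Continuous g)
    (t : ℝ) : duhamel μ x f t - duhamel μ y g t = duhamel μ (x - y) (fun s => f s - g s) t := by
  simp only [duhamel, smul_sub]
  rw [intervalIntegral.integral_sub (Continuous.intervalIntegrable (by fun_prop) _ _)
    (Continuous.intervalIntegrable (by fun_prop) _ _), ← smul_sub]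
  congr 1
  abel

end Duhamel

/-! ### Quadratic convolutions of sequences -/

section Quadratic

variable {ι : Type*} [AddCommGroup ι] {𝕜 : Type*} [RCLike 𝕜]

/-- The weighted convolution `∑ⱼ m(j, k-j) cⱼ c_{k-j}`. -/
def quadratic (m : ι → ι → ℝ) (c : ι → 𝕜) (k : ι) : 𝕜 :=
  ∑' j, m j (k - j) • (c j * c (k - j))

theorem quadratic_eq_sum (m : ι → ι → ℝ) {c : ι → 𝕜} {S : Finset ι} (hc : ∀ j ∉ S, c j = 0)
    (k : ι) : quadratic m c k = ∑ j ∈ S, m j (k - j) • (c j * c (k - j)) :=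
  tsum_eq_sum fun j hj => by simp [hc j hj]

theorem norm_quadratic_le {m : ι → ι → ℝ} {c : ι → 𝕜} {g : ι → ℝ} (hc : ∀ j, ‖c j‖ ≤ g j) (k : ι)
    (hs : Summable fun j => |m j (k - j)| • (g j * g (k - j))) :
    ‖quadratic m c k‖ ≤ quadratic (fun j l => |m j l|) g k := by
  refine tsum_of_norm_bounded hs.hasSum fun j => ?_
  rw [norm_smul, norm_mul, Real.norm_eq_abs, smul_eq_mul]
  have := hc j
  have := hc (k - j)
  gcongr
  exact (norm_nonneg _).trans (hc j)

/-- The splitting `cc' - dd' = (c - d)c' + d(c' - d')` is applied to both sides and compared term by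
term. Domination of differences by differences is the form that survives induction along the
iteration. -/
theorem norm_quadratic_sub_le {m : ι → ι → ℝ} {c d : ι → 𝕜} {g h : ι → ℝ}
    (hc : ∀ j, ‖c j‖ ≤ g j) (hd : ∀ j, ‖d j‖ ≤ h j) (hcd : ∀ j, ‖c j - d j‖ ≤ g j - h j) (k : ι)
    (hs : Summable fun j => |m j (k - j)| • (g j * g (k - j))) :
    ‖quadratic m c k - quadratic m d k‖ ≤
      quadratic (fun j l => |m j l|) g k - quadratic (fun j l => |m j l|) h k := by
  have hh : ∀ j, 0 ≤ h j := fun j => (norm_nonneg _).trans (hd j)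
  have hg : ∀ j, 0 ≤ g j := fun j => (norm_nonneg _).trans (hc j)
  have hhg : ∀ j, h j ≤ g j := fun j => sub_nonneg.1 ((norm_nonneg _).trans (hcd j))
  have hs' : Summable fun j => |m j (k - j)| • (h j * h (k - j)) := by
    refine hs.of_nonneg_of_le (fun j => ?_) fun j => ?_
    · exact mul_nonneg (abs_nonneg _) (mul_nonneg (hh _) (hh _))
    · exact mul_le_mul_of_nonneg_left (mul_le_mul (hhg _) (hhg _) (hh _) (hg _)) (abs_nonneg _)
  have sc : Summable fun j => m j (k - j) • (c j * c (k - j)) := by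
    refine .of_norm_bounded hs fun j => ?_
    rw [norm_smul, norm_mul, Real.norm_eq_abs, smul_eq_mul]
    exact mul_le_mul_of_nonneg_left (mul_le_mul (hc _) (hc _) (norm_nonneg _) (hg _)) (abs_nonneg _)
  have sd : Summable fun j => m j (k - j) • (d j * d (k - j)) := by
    refine .of_norm_bounded hs' fun j => ?_
    rw [norm_smul, norm_mul, Real.norm_eq_abs, smul_eq_mul]
    exact mul_le_mul_of_nonneg_left (mul_le_mul (hd _) (hd _) (norm_nonneg _) (hh _)) (abs_nonneg _)
  rw [quadratic, quadratic, quadratic, quadratic, ← sc.tsum_sub sd, ← hs.tsum_sub hs']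
  refine tsum_of_norm_bounded (hs.sub hs').hasSum fun j => ?_
  rw [← smul_sub, ← smul_sub, norm_smul, Real.norm_eq_abs, smul_eq_mul]
  refine mul_le_mul_of_nonneg_left ?_ (abs_nonneg _)
  have e : c j * c (k - j) - d j * d (k - j) =
      (c j - d j) * c (k - j) + d j * (c (k - j) - d (k - j)) := by ring
  have e' : g j * g (k - j) - h j * h (k - j) =
      (g j - h j) * g (k - j) + h j * (g (k - j) - h (k - j)) := by ring
  rw [e, e']
  refine (norm_add_le _ _).trans (add_le_add ?_ ?_) <;> rw [norm_mul]
  · exact mul_le_mul (hcd _) (hc _) (norm_nonneg _) (sub_nonneg.2 (hhg _))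
  · exact mul_le_mul (hd _) (hcd _) (norm_nonneg _) (hh _)

end Quadratic

/-! ### Truncated Picard iteration -/

section Picard

variable {ι : Type*} [AddCommGroup ι] [DecidableEq ι] {𝕜 : Type*} [RCLike 𝕜]

/-- Picard iterates of `cₖ' = -Λₖ cₖ + ∑ⱼ m(j, k-j) cⱼ c_{k-j}`, `c 0 = x`, the `(n+1)`-st
restricted to the modes in `S n`. -/
def picard (S : ℕ → Finset ι) (Λ : ι → ℝ) (m : ι → ι → ℝ) (x : ι → 𝕜) : ℕ → ι → ℝ → 𝕜
  | 0 => fun _ _ => 0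
  | n + 1 => fun k =>
    if k ∈ S n then
      duhamel (Λ k) (x k) fun s => quadratic m (fun j => picard S Λ m x n j s) k
    else fun _ => 0

variable {S : ℕ → Finset ι} {Λ : ι → ℝ} {m : ι → ι → ℝ} {x : ι → 𝕜}

theorem picard_succ_of_notMem {n : ℕ} {k : ι} (hk : k ∉ S n) (t : ℝ) :
    picard S Λ m x (n + 1) k t = 0 := by
  simp [picard, hk]

theorem picard_succ_of_mem {n : ℕ} {k : ι} (hk : k ∈ S n) :
    picard S Λ m x (n + 1) k =
      duhamel (Λ k) (x k) fun s => quadratic m (fun j => picard S Λ m x n j s) k := by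
  simp [picard, hk]

/-- Iterate `n + 1` lives on `S n`, hence iterate `n` does too as the truncations grow. The
quadratic term is thus a finite sum, and regularity in time needs no convergence argument. -/
theorem picard_of_notMem (hS : Monotone S) {n : ℕ} {k : ι} (hk : k ∉ S n) (t : ℝ) :
    picard S Λ m x n k t = 0 := by
  cases n with
  | zero => rfl
  | succ n => exact picard_succ_of_notMem (fun h => hk (hS n.le_succ h)) t

theorem quadratic_picard_eq_sum (hS : Monotone S) (n : ℕ) (k : ι) (t : ℝ) :
    quadratic m (fun j => picard S Λ m x n j t) k =
      ∑ j ∈ S n, m j (k - j) • (picard S Λ m x n j t * picard S Λ m x n (k - j) t) :=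
  quadratic_eq_sum m (fun _ hj => picard_of_notMem hS hj t) k

theorem continuous_picard (hS : Monotone S) (n : ℕ) (k : ι) :
    Continuous (picard S Λ m x n k) := by
  induction n generalizing k with
  | zero => exact continuous_const
  | succ n ih =>
    by_cases hk : k ∈ S n
    · rw [picard_succ_of_mem hk]
      refine continuous_duhamel _ _ ?_
      simp only [quadratic_picard_eq_sum hS]
      fun_prop
    · simpa [picard, hk] using continuous_const

theorem continuous_quadratic_picard (hS : Monotone S) (n : ℕ) (k : ι) :
    Continuous fun t => quadratic m (fun j => picard S Λ m x n j t) k := by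
  have := continuous_picard (Λ := Λ) (m := m) (x := x) hS n
  simp only [quadratic_picard_eq_sum hS]
  fun_prop

theorem hasDerivAt_picard (hS : Monotone S) {n : ℕ} {k : ι} (hk : k ∈ S n) (t : ℝ) :
    HasDerivAt (picard S Λ m x (n + 1) k) (-Λ k • picard S Λ m x (n + 1) k t +
      quadratic m (fun j => picard S Λ m x n j t) k) t := by
  rw [picard_succ_of_mem hk]
  exact hasDerivAt_duhamel _ _ (continuous_quadratic_picard hS n k) t

variable (S Λ m x) in
/-- The majorant of the Picard iterates. -/
def majorant (n : ℕ) (k : ι) (t : ℝ) : ℝ :=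
  picard S Λ (fun j l => |m j l|) (fun k => ‖x k‖) n k t

theorem continuous_majorant (hS : Monotone S) (n : ℕ) (k : ι) :
    Continuous (majorant S Λ m x n k) :=
  continuous_picard (x := fun k => ‖x k‖) hS n k

theorem hasDerivAt_majorant (hS : Monotone S) {n : ℕ} {k : ι} (hk : k ∈ S n) (t : ℝ) :
    HasDerivAt (majorant S Λ m x (n + 1) k) (-Λ k • majorant S Λ m x (n + 1) k t +
      quadratic (fun j l => |m j l|) (fun j => majorant S Λ m x n j t) k) t :=
  hasDerivAt_picard (x := fun k => ‖x k‖) hS hk t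

theorem summable_majorant (hS : Monotone S) (n : ℕ) (k : ι) (t : ℝ) :
    Summable fun j => |m j (k - j)| • (majorant S Λ m x n j t * majorant S Λ m x n (k - j) t) :=
  summable_of_ne_finset_zero (s := S n) fun j hj => by
    simp [majorant, picard_of_notMem hS hj]

theorem norm_picard_le (hS : Monotone S) (n : ℕ) (k : ι) {t : ℝ} (ht : 0 ≤ t) :
    ‖picard S Λ m x n k t‖ ≤ majorant S Λ m x n k t := by
  induction n generalizing k t with
  | zero => simp [picard, majorant]
  | succ n ih =>
    by_cases hk : k ∈ S n
    · rw [majorant, picard_succ_of_mem hk, picard_succ_of_mem hk]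
      exact norm_duhamel_le le_rfl (continuous_quadratic_picard hS n k) ht fun s hs =>
        norm_quadratic_le (fun j => ih j hs) k (summable_majorant hS n k s)
    · simp [majorant, picard_succ_of_notMem hk]

/-- On a mode active in both steps the data cancel and Duhamel compares the forcings; on a mode not
yet active the older iterate vanishes and `norm_picard_le` suffices. The bound telescopes in `n`,
and its right side, being nonnegative, makes the majorants monotone. -/
theorem norm_picard_succ_sub_le (hS : Monotone S) (n : ℕ) (k : ι) {t : ℝ} (ht : 0 ≤ t) :
    ‖picard S Λ m x (n + 1) k t - picard S Λ m x n k t‖ ≤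
      majorant S Λ m x (n + 1) k t - majorant S Λ m x n k t := by
  induction n generalizing k t with
  | zero => simpa [picard, majorant] using norm_picard_le (m := m) hS 1 k ht
  | succ n ih =>
    by_cases hk : k ∈ S n
    · have hk' := hS n.le_succ hk
      have c1 := continuous_quadratic_picard (Λ := Λ) (m := m) (x := x) hS
      have c2 := continuous_quadratic_picard (Λ := Λ) (m := fun j l => |m j l|)
        (x := fun k => ‖x k‖) hS
      rw [majorant, majorant, picard_succ_of_mem hk, picard_succ_of_mem hk',
        picard_succ_of_mem hk, picard_succ_of_mem hk', duhamel_sub _ _ _ (c1 _ _) (c1 _ _),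
        duhamel_sub _ _ _ (c2 _ _) (c2 _ _)]
      refine norm_duhamel_le (by simp) ((c2 _ _).sub (c2 _ _)) ht fun s hs => ?_
      exact norm_quadratic_sub_le (fun j => norm_picard_le hS _ j hs)
        (fun j => norm_picard_le hS _ j hs) (fun j => ih j hs) k (summable_majorant hS _ k s)
    · rw [picard_succ_of_notMem hk, majorant, majorant, picard_succ_of_notMem hk]
      simpa [majorant] using norm_picard_le (m := m) hS _ k ht

theorem majorant_nonneg (hS : Monotone S) (n : ℕ) (k : ι) {t : ℝ} (ht : 0 ≤ t) :
    0 ≤ majorant S Λ m x n k t :=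
  (norm_nonneg (picard S Λ m x n k t)).trans (norm_picard_le hS n k ht)

theorem majorant_mono (hS : Monotone S) (k : ι) {t : ℝ} (ht : 0 ≤ t) :
    Monotone fun n => majorant S Λ m x n k t :=
  monotone_nat_of_le_succ fun n =>
    sub_nonneg.1 ((norm_nonneg (picard S Λ m x (n + 1) k t - picard S Λ m x n k t)).trans
      (norm_picard_succ_sub_le hS n k ht))

end Picard

/-! ### Uniform bounds for the Picard iterates -/

/-- A quadratic evolution equation for sequences, whose dissipation `Λ ≥ K w²` dominates its
nonlinearity `|m(j,l)| ≤ κ w(j) w(l)` for data of `ℓ¹` size at most `a`. The mode `0` stays zero. -/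
structure IsDissipative {ι : Type*} [AddCommGroup ι] {𝕜 : Type*} [RCLike 𝕜] (Λ : ι → ℝ)
    (m : ι → ι → ℝ) (w : ι → ℝ) (x : ι → 𝕜) (K κ a : ℝ) : Prop where
  one_le : ∀ k, k ≠ 0 → 1 ≤ w k
  weight_nonneg : ∀ k, 0 ≤ w k
  le_dissipation : ∀ k, K * w k ^ 2 ≤ Λ k
  abs_kernel_le : ∀ j l, |m j l| ≤ κ * (w j * w l)
  kernel_neg : ∀ j, m j (-j) = 0
  data_zero : x 0 = 0
  sum_data_le : ∀ s : Finset ι, ∑ k ∈ s, ‖x k‖ ≤ a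
  κ_nonneg : 0 ≤ κ
  small : κ * a < K

theorem data_bound_nonneg {ι : Type*} [AddCommGroup ι] {𝕜 : Type*} [RCLike 𝕜] {Λ : ι → ℝ}
    {m : ι → ι → ℝ} {w : ι → ℝ} {x : ι → 𝕜} {K κ a : ℝ} (h : IsDissipative Λ m w x K κ a) :
    0 ≤ a := by
  simpa using h.sum_data_le ∅

/-- Translation is injective and `f` vanishes off `s`, so the shifted sum meets each nonnegative
term at most once. -/
theorem sum_sub_le_sum_of_support {ι : Type*} [AddCommGroup ι] [DecidableEq ι] {f : ι → ℝ}
    (hf : ∀ k, 0 ≤ f k) {s : Finset ι} (hs : ∀ k ∉ s, f k = 0) (j : ι) :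
    ∑ k ∈ s, f (k - j) ≤ ∑ k ∈ s, f k := by
  rw [← Finset.sum_image (f := f) (g := fun k => k - j) (fun _ _ _ _ h => sub_left_injective h)]
  calc ∑ k ∈ s.image (fun k => k - j), f k ≤ ∑ k ∈ s.image (fun k => k - j) ∪ s, f k :=
        Finset.sum_le_sum_of_subset_of_nonneg Finset.subset_union_left fun k _ _ => hf k
    _ = ∑ k ∈ s, f k := (Finset.sum_subset Finset.subset_union_right fun k _ hk => hs k hk).symm

section Bounds

variable {ι : Type*} [AddCommGroup ι] [DecidableEq ι] {𝕜 : Type*} [RCLike 𝕜]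
  {S : ℕ → Finset ι} {Λ : ι → ℝ} {m : ι → ι → ℝ} {w : ι → ℝ} {x : ι → 𝕜} {K κ a : ℝ}

/-- Pairs of opposite modes do not interact and the datum has no mode `0`. This matters because the
weight has no positive lower bound at `0`, so the dissipation could not control that mode. -/
theorem majorant_zero_mode (h : IsDissipative Λ m w x K κ a) (n : ℕ) (t : ℝ) :
    majorant S Λ m x n 0 t = 0 := by
  cases n with
  | zero => rfl
  | succ n =>
    by_cases h0 : (0 : ι) ∈ S n <;>
      simp [majorant, picard, h0, duhamel, quadratic, h.kernel_neg, h.data_zero]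

variable (S Λ m x) in
/-- The `ℓ¹` norm of a majorant. -/
def energy (n : ℕ) (t : ℝ) : ℝ := ∑ k ∈ S n, majorant S Λ m x (n + 1) k t

variable (S Λ m w x) in
/-- The weighted `ℓ¹` norm of a majorant. -/
def dissipation (n : ℕ) (t : ℝ) : ℝ := ∑ k ∈ S n, w k ^ 2 * majorant S Λ m x (n + 1) k t

variable (S Λ m x) in
/-- The time derivative of `energy`. -/
def energyDeriv (n : ℕ) (t : ℝ) : ℝ :=
  ∑ k ∈ S n, (-Λ k • majorant S Λ m x (n + 1) k t +
    quadratic (fun j l => |m j l|) (fun j => majorant S Λ m x n j t) k)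

theorem hasDerivAt_energy (hS : Monotone S) (n : ℕ) (t : ℝ) :
    HasDerivAt (energy S Λ m x n) (energyDeriv S Λ m x n t) t :=
  HasDerivAt.fun_sum fun _ hk => hasDerivAt_majorant hS hk t

theorem continuous_energy (hS : Monotone S) (n : ℕ) : Continuous (energy S Λ m x n) :=
  continuous_iff_continuousAt.2 fun t => (hasDerivAt_energy hS n t).continuousAt

theorem continuous_dissipation (hS : Monotone S) (n : ℕ) :
    Continuous (dissipation S Λ m w x n) :=
  continuous_finsetSum _ fun k _ => continuous_const.mul (continuous_majorant hS (n + 1) k)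

theorem energy_zero_le (h : IsDissipative Λ m w x K κ a) (n : ℕ) : energy S Λ m x n 0 ≤ a := by
  refine le_trans (le_of_eq ?_) (h.sum_data_le (S n))
  exact Finset.sum_congr rfl fun k hk => by simp [majorant, picard, hk, duhamel_zero]

theorem energy_le_dissipation (h : IsDissipative Λ m w x K κ a) (hS : Monotone S) (n : ℕ) {t : ℝ}
    (ht : 0 ≤ t) : energy S Λ m x n t ≤ dissipation S Λ m w x n t := by
  refine Finset.sum_le_sum fun k _ => ?_
  rcases eq_or_ne k 0 with rfl | hk
  · simp [majorant_zero_mode h]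
  · exact le_mul_of_one_le_left (majorant_nonneg hS _ k ht) (one_le_pow₀ (h.one_le k hk))

theorem dissipation_nonneg (hS : Monotone S) (n : ℕ) {t : ℝ}
    (ht : 0 ≤ t) : 0 ≤ dissipation S Λ m w x n t :=
  Finset.sum_nonneg fun k _ => mul_nonneg (sq_nonneg _) (majorant_nonneg hS _ k ht)

/-- The forcing comes from iterate `n`, but monotonicity replaces it by iterate `n + 1`, so the
estimate closes on a single iterate. The factorized kernel bound then leaves `(∑ w g)²`. -/
theorem sum_quadratic_majorant_le (h : IsDissipative Λ m w x K κ a) (hS : Monotone S) (n : ℕ)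
    {t : ℝ} (ht : 0 ≤ t) :
    ∑ k ∈ S n, quadratic (fun j l => |m j l|) (fun j => majorant S Λ m x n j t) k ≤
      κ * (energy S Λ m x n t * dissipation S Λ m w x n t) := by
  set g := fun k => majorant S Λ m x (n + 1) k t
  have hg : ∀ k, 0 ≤ g k := fun k => majorant_nonneg hS _ k ht
  have hg0 : ∀ k ∉ S n, g k = 0 := fun k hk => picard_succ_of_notMem hk t
  have hwg : ∀ k, 0 ≤ w k * g k := fun k => mul_nonneg (h.weight_nonneg k) (hg k)
  calc ∑ k ∈ S n, quadratic (fun j l => |m j l|) (fun j => majorant S Λ m x n j t) k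
      ≤ ∑ k ∈ S n, ∑ j ∈ S n, κ * ((w j * g j) * (w (k - j) * g (k - j))) := by
        refine Finset.sum_le_sum fun k _ => ?_
        rw [show quadratic (fun j l => |m j l|) (fun j => majorant S Λ m x n j t) k = _ from
          quadratic_picard_eq_sum hS n k t]
        refine Finset.sum_le_sum fun j _ => ?_
        calc |m j (k - j)| • (majorant S Λ m x n j t * majorant S Λ m x n (k - j) t)
            ≤ (κ * (w j * w (k - j))) * (g j * g (k - j)) := by
              rw [smul_eq_mul]
              refine mul_le_mul (h.abs_kernel_le _ _) (mul_le_mul ?_ ?_ ?_ (hg _)) ?_ ?_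
              · exact majorant_mono hS j ht n.le_succ
              · exact majorant_mono hS (k - j) ht n.le_succ
              · exact majorant_nonneg hS _ _ ht
              · exact mul_nonneg (majorant_nonneg hS _ _ ht) (majorant_nonneg hS _ _ ht)
              · exact mul_nonneg h.κ_nonneg (mul_nonneg (h.weight_nonneg _) (h.weight_nonneg _))
          _ = _ := by ring
    _ = κ * ∑ j ∈ S n, (w j * g j) * ∑ k ∈ S n, w (k - j) * g (k - j) := by
        rw [Finset.sum_comm]
        simp only [Finset.mul_sum]
    _ ≤ κ * ∑ j ∈ S n, (w j * g j) * ∑ k ∈ S n, w k * g k := by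
        refine mul_le_mul_of_nonneg_left (Finset.sum_le_sum fun j _ => ?_) h.κ_nonneg
        refine mul_le_mul_of_nonneg_left ?_ (hwg j)
        exact sum_sub_le_sum_of_support hwg (fun k hk => by rw [hg0 k hk, mul_zero]) j
    _ = κ * (∑ j ∈ S n, w j * g j) ^ 2 := by rw [← Finset.sum_mul, sq]
    -- Cauchy–Schwarz, from `(w g)² = g · (w² g)`.
    _ ≤ κ * (energy S Λ m x n t * dissipation S Λ m w x n t) := by
        refine mul_le_mul_of_nonneg_left ?_ h.κ_nonneg
        refine Finset.sum_sq_le_sum_mul_sum_of_sq_le_mul _ (fun k _ => hg k)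
          (fun k _ => mul_nonneg (sq_nonneg _) (hg k)) fun k _ => le_of_eq ?_
        ring

theorem energyDeriv_le (h : IsDissipative Λ m w x K κ a) (hS : Monotone S) (n : ℕ) {t : ℝ}
    (ht : 0 ≤ t) :
    energyDeriv S Λ m x n t ≤ -(K - κ * energy S Λ m x n t) * dissipation S Λ m w x n t := by
  have h1 : ∑ k ∈ S n, -Λ k • majorant S Λ m x (n + 1) k t ≤ -K * dissipation S Λ m w x n t := by
    rw [dissipation, Finset.mul_sum]
    refine Finset.sum_le_sum fun k _ => ?_
    rw [smul_eq_mul, ← mul_assoc]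
    refine mul_le_mul_of_nonneg_right ?_ (majorant_nonneg hS _ k ht)
    linarith [h.le_dissipation k]
  rw [energyDeriv, Finset.sum_add_distrib]
  linarith [sum_quadratic_majorant_le h hS n ht]

/-- Exponential decay of the `ℓ¹` norm, uniformly along the iteration. -/
theorem energy_le (h : IsDissipative Λ m w x K κ a) (hS : Monotone S) (n : ℕ) {t : ℝ}
    (ht : 0 ≤ t) : energy S Λ m x n t ≤ a * Real.exp (-(K - κ * a) * t) := by
  have ha := data_bound_nonneg h
  -- Barrier argument with room `δ`: enlarging `a` keeps the barrier positive even when `a = 0`, and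
  -- giving up `δ` in the rate makes the derivative inequality strict where the curves touch. At the
  -- end `δ → 0⁺`.
  have key : ∀ δ : ℝ, 0 < δ → 0 < K - κ * (a + δ) - δ →
      energy S Λ m x n t ≤ (a + δ) * Real.exp (-(K - κ * (a + δ) - δ) * t) := by
    intro δ hδ hμ
    set μ := K - κ * (a + δ) - δ with hμ_def
    have hB : ∀ s, HasDerivAt (fun s => (a + δ) * Real.exp (-μ * s))
        ((a + δ) * (Real.exp (-μ * s) * -μ)) s := fun s => by
      simpa using (((hasDerivAt_id s).const_mul (-μ)).exp).const_mul (a + δ)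
    refine image_le_of_deriv_right_lt_deriv_boundary (a := 0) (b := t)
      (f := energy S Λ m x n) (f' := energyDeriv S Λ m x n)
      (continuous_energy hS n).continuousOn
      (fun s _ => (hasDerivAt_energy hS n s).hasDerivWithinAt) ?_ hB ?_ ⟨ht, le_rfl⟩
    · simpa using (energy_zero_le h n).trans (by linarith)
    -- At a touching time the energy is at most `a + δ`, so `K - κE ≥ μ + δ`; with dissipation at
    -- least `E` this gives `E' ≤ -(μ + δ)E < -μE`.
    · intro s hs hEB
      have hpos : 0 < (a + δ) * Real.exp (-μ * s) := by positivity
      have hle : energy S Λ m x n s ≤ a + δ := by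
        rw [hEB]
        refine mul_le_of_le_one_right (by linarith) (Real.exp_le_one_iff.2 ?_)
        nlinarith [hs.1]
      have hF := energy_le_dissipation h hS n hs.1
      have hd := energyDeriv_le h hS n hs.1
      have hκ := mul_le_mul_of_nonneg_left hle h.κ_nonneg
      have h1 : (μ + δ) * energy S Λ m x n s ≤
          (K - κ * energy S Λ m x n s) * dissipation S Λ m w x n s := by
        refine mul_le_mul (by linarith) hF (by rw [hEB]; exact hpos.le) (by linarith)
      have h2 : 0 < δ * energy S Λ m x n s := by rw [hEB]; positivity
      have h3 : (a + δ) * (Real.exp (-μ * s) * -μ) = -μ * energy S Λ m x n s := by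
        rw [hEB]; ring
      rw [h3]
      linarith
  have hc : Continuous fun δ : ℝ => (a + δ) * Real.exp (-(K - κ * (a + δ) - δ) * t) := by fun_prop
  have hc' : Continuous fun δ : ℝ => K - κ * (a + δ) - δ := by fun_prop
  have hlim := (hc.tendsto 0).mono_left (nhdsWithin_le_nhds (s := Ioi 0))
  have hpos : ∀ᶠ δ : ℝ in nhdsWithin 0 (Ioi 0), 0 < K - κ * (a + δ) - δ := by
    refine nhdsWithin_le_nhds (hc'.continuousAt.eventually_const_lt ?_)
    simpa using h.small
  have := ge_of_tendsto hlim (b := energy S Λ m x n t) ?_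
  · simpa using this
  · filter_upwards [hpos, self_mem_nhdsWithin] with δ h1 h2 using key δ h2 h1

theorem energy_le_data (h : IsDissipative Λ m w x K κ a) (hS : Monotone S) (n : ℕ) {t : ℝ}
    (ht : 0 ≤ t) : energy S Λ m x n t ≤ a := by
  refine (energy_le h hS n ht).trans (mul_le_of_le_one_right (data_bound_nonneg h) ?_)
  refine Real.exp_le_one_iff.2 ?_
  nlinarith [h.small]

/-- The quantity `E(t) + (K - κa) ∫₀ᵗ D` has nonpositive derivative, because `E ≤ a`, and starts
below `a`; dropping `E(T) ≥ 0` leaves the bound. -/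
theorem integral_dissipation_le (h : IsDissipative Λ m w x K κ a) (hS : Monotone S) (n : ℕ) {T : ℝ}
    (hT : 0 ≤ T) : ∫ t in (0 : ℝ)..T, dissipation S Λ m w x n t ≤ a / (K - κ * a) := by
  have hν : 0 < K - κ * a := sub_pos.2 h.small
  have hc := continuous_dissipation (Λ := Λ) (m := m) (w := w) (x := x) hS n
  have hd : ∀ t, HasDerivAt (fun t => energy S Λ m x n t +
      (K - κ * a) * ∫ s in (0 : ℝ)..t, dissipation S Λ m w x n s)
      (energyDeriv S Λ m x n t + (K - κ * a) * dissipation S Λ m w x n t) t := fun t =>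
    (hasDerivAt_energy hS n t).add ((intervalIntegral.integral_hasDerivAt_right
      (hc.intervalIntegrable _ _) hc.stronglyMeasurable.stronglyMeasurableAtFilter
      hc.continuousAt).const_mul _)
  have := image_le_of_deriv_right_le_deriv_boundary (a := 0) (b := T) (B := fun _ => a)
    (B' := fun _ => 0) (fun t _ => (hd t).continuousAt.continuousWithinAt)
    (fun t _ => (hd t).hasDerivWithinAt) (by simpa using energy_zero_le h n) continuousOn_const
    (fun t _ => hasDerivWithinAt_const _ _ _) (fun t ht => ?_) ⟨hT, le_rfl⟩
  · rw [le_div_iff₀ hν]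
    have h0 : 0 ≤ energy S Λ m x n T := Finset.sum_nonneg fun k _ => majorant_nonneg hS _ k hT
    linarith
  · have h1 := energyDeriv_le h hS n ht.1
    have h2 := mul_le_mul_of_nonneg_left (energy_le_data h hS n ht.1) h.κ_nonneg
    have h3 := mul_le_mul_of_nonneg_right h2 (dissipation_nonneg (Λ := Λ) (m := m) (w := w)
      (x := x) hS n ht.1)
    linarith

end Bounds

/-! ### Convolution estimates for summable sequences -/

section Convolution

variable {ι : Type*} [AddCommGroup ι]

/-- `(k, j) ↦ (j, k - j)`. -/
def convolutionEquiv (ι : Type*) [AddCommGroup ι] : ι × ι ≃ ι × ι where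
  toFun p := (p.2, p.1 - p.2)
  invFun p := (p.1 + p.2, p.1)
  left_inv p := by simp
  right_inv p := by simp

theorem summable_convolution {A : Type*} [NormedRing A] [CompleteSpace A] {f g : ι → A}
    (hf : Summable fun k => ‖f k‖) (hg : Summable fun k => ‖g k‖) :
    Summable fun p : ι × ι => f p.2 * g (p.1 - p.2) :=
  (convolutionEquiv ι).summable_iff.2 (summable_mul_of_summable_norm hf hg)

theorem hasSum_convolution {A : Type*} [NormedRing A] [CompleteSpace A] {f g : ι → A}
    (hf : Summable fun k => ‖f k‖) (hg : Summable fun k => ‖g k‖) :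
    HasSum (fun k => ∑' j, f j * g (k - j)) ((∑' k, f k) * ∑' k, g k) := by
  have h := summable_convolution hf hg
  have h2 := h.hasSum.prod_fiberwise fun k => (h.prod_factor k).hasSum
  have e : ∑' p : ι × ι, f p.2 * g (p.1 - p.2) = (∑' k, f k) * ∑' k, g k := by
    rw [tsum_mul_tsum_of_summable_norm hf hg]
    exact (convolutionEquiv ι).tsum_eq fun p : ι × ι => f p.1 * g p.2
  rwa [e] at h2

/-- Cauchy–Schwarz on finite sets bounds all partial sums at once, giving both summability and the
interpolation inequality. -/
theorem summable_weight_mul {ι : Type*} {w g : ι → ℝ} (hw : ∀ k, 0 ≤ w k) (hg : ∀ k, 0 ≤ g k)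
    (h0 : Summable g) (h2 : Summable fun k => w k ^ 2 * g k) :
    Summable (fun k => w k * g k) ∧
      (∑' k, w k * g k) ^ 2 ≤ (∑' k, g k) * ∑' k, w k ^ 2 * g k := by
  have hfin : ∀ s : Finset ι,
      ∑ k ∈ s, w k * g k ≤ √((∑' k, g k) * ∑' k, w k ^ 2 * g k) := by
    intro s
    refine Real.le_sqrt_of_sq_le ?_
    refine (Finset.sum_sq_le_sum_mul_sum_of_sq_le_mul s (f := g) (g := fun k => w k ^ 2 * g k)
      (fun k _ => hg k) (fun k _ => mul_nonneg (sq_nonneg _) (hg k))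
      fun k _ => le_of_eq (by ring)).trans ?_
    refine mul_le_mul (h0.sum_le_tsum s fun k _ => hg k)
      (h2.sum_le_tsum s fun k _ => mul_nonneg (sq_nonneg _) (hg k)) ?_ (tsum_nonneg hg)
    exact Finset.sum_nonneg fun k _ => mul_nonneg (sq_nonneg _) (hg k)
  have hwg : ∀ k, 0 ≤ w k * g k := fun k => mul_nonneg (hw k) (hg k)
  have hs := summable_of_sum_le hwg hfin
  refine ⟨hs, ?_⟩
  have := hs.tsum_le_of_sum_le hfin
  calc (∑' k, w k * g k) ^ 2 ≤ √((∑' k, g k) * ∑' k, w k ^ 2 * g k) ^ 2 :=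
        pow_le_pow_left₀ (tsum_nonneg hwg) this 2
    _ = _ := Real.sq_sqrt (mul_nonneg (tsum_nonneg hg)
        (tsum_nonneg fun k => mul_nonneg (sq_nonneg _) (hg k)))

variable {m : ι → ι → ℝ} {w g : ι → ℝ} {κ : ℝ}

theorem abs_kernel_smul_le {ι : Type*} {m : ι → ι → ℝ} {w g : ι → ℝ} {κ : ℝ}
    (hg : ∀ k, 0 ≤ g k) (hm : ∀ j l, |m j l| ≤ κ * (w j * w l)) (j l : ι) :
    |m j l| • (g j * g l) ≤ κ * ((w j * g j) * (w l * g l)) := by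
  calc |m j l| • (g j * g l) ≤ (κ * (w j * w l)) * (g j * g l) :=
        mul_le_mul_of_nonneg_right (hm j l) (mul_nonneg (hg _) (hg _))
    _ = _ := by ring

theorem summable_kernel_mul (hw : ∀ k, 0 ≤ w k) (hg : ∀ k, 0 ≤ g k)
    (hm : ∀ j l, |m j l| ≤ κ * (w j * w l)) (h0 : Summable g)
    (h2 : Summable fun k => w k ^ 2 * g k) :
    Summable fun p : ι × ι => |m p.2 (p.1 - p.2)| • (g p.2 * g (p.1 - p.2)) := by
  have hs := (summable_weight_mul hw hg h0 h2).1
  refine ((summable_convolution hs.norm hs.norm).mul_left κ).of_nonneg_of_le (fun p => ?_) fun p =>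
    abs_kernel_smul_le hg hm _ _
  exact mul_nonneg (abs_nonneg _) (mul_nonneg (hg _) (hg _))

/-- The infinite counterpart of `sum_quadratic_majorant_le`: the convolution of `w g` with itself
has total mass `(∑ w g)²`. Allowing any dominating `g` lets one majorant serve all iterates. -/
theorem summable_norm_quadratic {𝕜 : Type*} [RCLike 𝕜] {c : ι → 𝕜} (hc : ∀ k, ‖c k‖ ≤ g k)
    (hw : ∀ k, 0 ≤ w k) (hm : ∀ j l, |m j l| ≤ κ * (w j * w l)) (hκ : 0 ≤ κ) (h0 : Summable g)
    (h2 : Summable fun k => w k ^ 2 * g k) :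
    (Summable fun k => ‖quadratic m c k‖) ∧
      ∑' k, ‖quadratic m c k‖ ≤ κ * ((∑' k, g k) * ∑' k, w k ^ 2 * g k) := by
  have hg : ∀ k, 0 ≤ g k := fun k => (norm_nonneg _).trans (hc k)
  have hS := summable_kernel_mul hw hg hm h0 h2
  have hs := summable_weight_mul hw hg h0 h2
  have hconv := (hasSum_convolution hs.1.norm hs.1.norm).mul_left κ
  have hle : ∀ k, ‖quadratic m c k‖ ≤ κ * ∑' j, (w j * g j) * (w (k - j) * g (k - j)) := by
    intro k
    refine (norm_quadratic_le hc k (hS.prod_factor k)).trans ?_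
    rw [← tsum_mul_left]
    exact (hS.prod_factor k).tsum_le_tsum (fun j => abs_kernel_smul_le hg hm _ _)
      (((summable_convolution hs.1.norm hs.1.norm).prod_factor k).mul_left κ)
  have hsum := hconv.summable.of_nonneg_of_le (fun _ => norm_nonneg _) hle
  refine ⟨hsum, (hsum.tsum_le_tsum hle hconv.summable).trans ?_⟩
  rw [hconv.tsum_eq, ← sq]
  exact mul_le_mul_of_nonneg_left hs.2 hκ

end Convolution

open Filter Topology ComplexConjugate

/-! ### The limit of the Picard iterates -/

section Limit

variable {ι : Type*} [AddCommGroup ι] [DecidableEq ι] {𝕜 : Type*} [RCLike 𝕜]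
  {S : ℕ → Finset ι} {Λ : ι → ℝ} {m : ι → ι → ℝ} {w : ι → ℝ} {x : ι → 𝕜} {K κ a : ℝ}

variable (S Λ m x) in
/-- The limit of the Picard iterates; it is constant for negative times. -/
def picardLim (k : ι) (t : ℝ) : 𝕜 := limUnder atTop fun n => picard S Λ m x n k (max t 0)

variable (S Λ m x) in
/-- The limit of the majorants; it is constant for negative times. -/
def majorantLim (k : ι) (t : ℝ) : ℝ := ⨆ n, majorant S Λ m x n k (max t 0)

theorem sum_majorant_le_energy (hS : Monotone S) (n : ℕ) {t : ℝ} (ht : 0 ≤ t) (s : Finset ι) :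
    ∑ k ∈ s, majorant S Λ m x n k t ≤ energy S Λ m x n t := by
  calc ∑ k ∈ s, majorant S Λ m x n k t ≤ ∑ k ∈ s, majorant S Λ m x (n + 1) k t :=
        Finset.sum_le_sum fun k _ => majorant_mono hS k ht n.le_succ
    _ ≤ ∑ k ∈ s ∪ S n, majorant S Λ m x (n + 1) k t :=
        Finset.sum_le_sum_of_subset_of_nonneg Finset.subset_union_left
          fun k _ _ => majorant_nonneg hS _ k ht
    _ = energy S Λ m x n t := (Finset.sum_subset Finset.subset_union_right
          fun k _ hk => picard_succ_of_notMem hk t).symm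

theorem sum_majorant_le_dissipation (hS : Monotone S) (n : ℕ) {t : ℝ} (ht : 0 ≤ t)
    (s : Finset ι) :
    ∑ k ∈ s, w k ^ 2 * majorant S Λ m x n k t ≤ dissipation S Λ m w x n t := by
  calc ∑ k ∈ s, w k ^ 2 * majorant S Λ m x n k t
      ≤ ∑ k ∈ s, w k ^ 2 * majorant S Λ m x (n + 1) k t :=
        Finset.sum_le_sum fun k _ =>
          mul_le_mul_of_nonneg_left (majorant_mono hS k ht n.le_succ) (sq_nonneg _)
    _ ≤ ∑ k ∈ s ∪ S n, w k ^ 2 * majorant S Λ m x (n + 1) k t :=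
        Finset.sum_le_sum_of_subset_of_nonneg Finset.subset_union_left
          fun k _ _ => mul_nonneg (sq_nonneg _) (majorant_nonneg hS _ k ht)
    _ = dissipation S Λ m w x n t := (Finset.sum_subset Finset.subset_union_right
          fun k _ hk => by
            rw [show majorant S Λ m x (n + 1) k t = 0 from picard_succ_of_notMem hk t,
              mul_zero]).symm

theorem majorant_le (h : IsDissipative Λ m w x K κ a) (hS : Monotone S) (n : ℕ) (k : ι) {t : ℝ}
    (ht : 0 ≤ t) : majorant S Λ m x n k t ≤ a := by
  simpa using (sum_majorant_le_energy hS n ht {k}).trans (energy_le_data h hS n ht)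

theorem bddAbove_majorant (h : IsDissipative Λ m w x K κ a) (hS : Monotone S) (k : ι) {t : ℝ}
    (ht : 0 ≤ t) : BddAbove (range fun n => majorant S Λ m x n k t) :=
  ⟨a, by rintro _ ⟨n, rfl⟩; exact majorant_le h hS n k ht⟩

theorem tendsto_majorant (h : IsDissipative Λ m w x K κ a) (hS : Monotone S) (k : ι) (t : ℝ) :
    Tendsto (fun n => majorant S Λ m x n k (max t 0)) atTop (𝓝 (majorantLim S Λ m x k t)) :=
  tendsto_atTop_ciSup (majorant_mono hS k (le_max_right t 0))
    (bddAbove_majorant h hS k (le_max_right t 0))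

theorem majorant_le_majorantLim (h : IsDissipative Λ m w x K κ a) (hS : Monotone S) (n : ℕ)
    (k : ι) (t : ℝ) : majorant S Λ m x n k (max t 0) ≤ majorantLim S Λ m x k t :=
  le_ciSup (bddAbove_majorant h hS k (le_max_right t 0)) n

theorem majorantLim_nonneg (h : IsDissipative Λ m w x K κ a) (hS : Monotone S) (k : ι) (t : ℝ) :
    0 ≤ majorantLim S Λ m x k t :=
  (majorant_nonneg hS 0 k (le_max_right t 0)).trans (majorant_le_majorantLim h hS 0 k t)

/-- The increments are dominated by a telescoping sum of majorants, which never exceeds `a`. -/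
theorem tendsto_picard (h : IsDissipative Λ m w x K κ a) (hS : Monotone S) (k : ι) (t : ℝ) :
    Tendsto (fun n => picard S Λ m x n k (max t 0)) atTop (𝓝 (picardLim S Λ m x k t)) := by
  have ht := le_max_right t 0
  refine CauchySeq.tendsto_limUnder (cauchySeq_of_summable_dist ?_)
  refine summable_of_sum_range_le (c := a) (fun _ => dist_nonneg) fun n => ?_
  calc ∑ i ∈ Finset.range n,
        dist (picard S Λ m x i k (max t 0)) (picard S Λ m x i.succ k (max t 0))
      ≤ ∑ i ∈ Finset.range n, (majorant S Λ m x (i + 1) k (max t 0) -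
          majorant S Λ m x i k (max t 0)) := by
        refine Finset.sum_le_sum fun i _ => ?_
        rw [dist_comm, dist_eq_norm]
        exact norm_picard_succ_sub_le hS i k ht
    _ = majorant S Λ m x n k (max t 0) := by
        rw [Finset.sum_range_sub fun i => majorant S Λ m x i k (max t 0)]
        simp [majorant, picard]
    _ ≤ a := majorant_le h hS n k ht

theorem norm_picardLim_le (h : IsDissipative Λ m w x K κ a) (hS : Monotone S) (k : ι) (t : ℝ) :
    ‖picardLim S Λ m x k t‖ ≤ majorantLim S Λ m x k t :=
  le_of_tendsto_of_tendsto' (tendsto_picard h hS k t).norm (tendsto_majorant h hS k t)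
    fun n => norm_picard_le hS n k (le_max_right t 0)

theorem measurable_picardLim (h : IsDissipative Λ m w x K κ a) (hS : Monotone S) (k : ι) :
    Measurable (picardLim S Λ m x k) :=
  measurable_of_tendsto_metrizable
    (fun n => ((continuous_picard hS n k).comp (continuous_id.max continuous_const)).measurable)
    (tendsto_pi_nhds.2 fun t => tendsto_picard h hS k t)

theorem measurable_majorantLim (h : IsDissipative Λ m w x K κ a) (hS : Monotone S) (k : ι) :
    Measurable (majorantLim S Λ m x k) :=
  measurable_of_tendsto_metrizable
    (fun n => ((continuous_majorant hS n k).comp (continuous_id.max continuous_const)).measurable)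
    (tendsto_pi_nhds.2 fun t => tendsto_majorant h hS k t)

theorem sum_majorantLim_le (h : IsDissipative Λ m w x K κ a) (hS : Monotone S) (t : ℝ)
    (s : Finset ι) :
    ∑ k ∈ s, majorantLim S Λ m x k t ≤ a * Real.exp (-(K - κ * a) * max t 0) :=
  le_of_tendsto' (tendsto_finsetSum s fun k _ => tendsto_majorant h hS k t) fun n =>
    (sum_majorant_le_energy hS n (le_max_right t 0) s).trans
      (energy_le h hS n (le_max_right t 0))

theorem summable_majorantLim (h : IsDissipative Λ m w x K κ a) (hS : Monotone S) (t : ℝ) :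
    Summable fun k => majorantLim S Λ m x k t :=
  summable_of_sum_le (fun k => majorantLim_nonneg h hS k t) (sum_majorantLim_le h hS t)

theorem tsum_majorantLim_le (h : IsDissipative Λ m w x K κ a) (hS : Monotone S) (t : ℝ) :
    ∑' k, majorantLim S Λ m x k t ≤ a * Real.exp (-(K - κ * a) * max t 0) :=
  (summable_majorantLim h hS t).tsum_le_of_sum_le (sum_majorantLim_le h hS t)

theorem tsum_majorantLim_le_data (h : IsDissipative Λ m w x K κ a) (hS : Monotone S) (t : ℝ) :
    ∑' k, majorantLim S Λ m x k t ≤ a := by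
  refine (tsum_majorantLim_le h hS t).trans (mul_le_of_le_one_right (data_bound_nonneg h) ?_)
  refine Real.exp_le_one_iff.2 ?_
  nlinarith [h.small, le_max_right t 0]

/-- Tonelli reduces the claim to finitely many modes, where Fatou carries over the uniform
dissipation bound. Working in `[0, ∞]` avoids presupposing summability, which is instead deduced for
almost every time. -/
theorem lintegral_tsum_majorantLim_le [Countable ι] (h : IsDissipative Λ m w x K κ a)
    (hS : Monotone S) (T : ℝ) :
    ∫⁻ t in Ioc 0 T, ∑' k, ENNReal.ofReal (w k ^ 2 * majorantLim S Λ m x k t) ≤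
      ENNReal.ofReal (a / (K - κ * a)) := by
  have hmeas : ∀ k, Measurable fun t => ENNReal.ofReal (w k ^ 2 * majorantLim S Λ m x k t) :=
    fun k => ((measurable_majorantLim h hS k).const_mul _).ennreal_ofReal
  rcases le_total T 0 with hT | hT
  · simp [Ioc_eq_empty_of_le hT]
  rw [lintegral_tsum fun k => (hmeas k).aemeasurable]
  refine ENNReal.summable.tsum_le_of_sum_le fun s => ?_
  rw [← lintegral_finsetSum s fun k _ => hmeas k]
  have hlim : ∀ t, Tendsto
      (fun n => ENNReal.ofReal (∑ k ∈ s, w k ^ 2 * majorant S Λ m x n k (max t 0))) atTop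
      (𝓝 (∑ k ∈ s, ENNReal.ofReal (w k ^ 2 * majorantLim S Λ m x k t))) := by
    intro t
    rw [← ENNReal.ofReal_sum_of_nonneg fun k _ =>
      mul_nonneg (sq_nonneg _) (majorantLim_nonneg h hS k t)]
    exact (ENNReal.continuous_ofReal.tendsto _).comp
      (tendsto_finsetSum s fun k _ => (tendsto_majorant h hS k t).const_mul _)
  calc ∫⁻ t in Ioc 0 T, ∑ k ∈ s, ENNReal.ofReal (w k ^ 2 * majorantLim S Λ m x k t)
      = ∫⁻ t in Ioc 0 T, liminf (fun n =>
          ENNReal.ofReal (∑ k ∈ s, w k ^ 2 * majorant S Λ m x n k (max t 0))) atTop :=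
        lintegral_congr fun t => (hlim t).liminf_eq.symm
    _ ≤ liminf (fun n => ∫⁻ t in Ioc 0 T,
          ENNReal.ofReal (∑ k ∈ s, w k ^ 2 * majorant S Λ m x n k (max t 0))) atTop := by
        refine lintegral_liminf_le fun n => ?_
        refine (Continuous.measurable ?_).ennreal_ofReal
        exact continuous_finsetSum _ fun k _ => continuous_const.mul
          ((continuous_majorant hS n k).comp (continuous_id.max continuous_const))
    _ ≤ ENNReal.ofReal (a / (K - κ * a)) := by
        refine liminf_le_of_le (by isBoundedDefault) fun b hb => ?_
        obtain ⟨n, hn⟩ := hb.exists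
        refine hn.trans ?_
        calc ∫⁻ t in Ioc 0 T, ENNReal.ofReal (∑ k ∈ s, w k ^ 2 * majorant S Λ m x n k (max t 0))
            ≤ ∫⁻ t in Ioc 0 T, ENNReal.ofReal (dissipation S Λ m w x n t) := by
              refine setLIntegral_mono' measurableSet_Ioc fun t ht => ?_
              rw [max_eq_left ht.1.le]
              exact ENNReal.ofReal_le_ofReal (sum_majorant_le_dissipation hS n ht.1.le s)
          _ = ENNReal.ofReal (∫ t in Ioc 0 T, dissipation S Λ m w x n t) := by
              refine (ofReal_integral_eq_lintegral_ofReal ?_ ?_).symm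
              · exact (continuous_dissipation hS n).integrableOn_Ioc
              · filter_upwards [ae_restrict_mem measurableSet_Ioc] with t ht using
                  dissipation_nonneg hS n ht.1.le
          _ ≤ _ := by
              rw [← intervalIntegral.integral_of_le hT]
              exact ENNReal.ofReal_le_ofReal (integral_dissipation_le h hS n hT)

theorem ae_summable_weight_majorantLim [Countable ι] (h : IsDissipative Λ m w x K κ a)
    (hS : Monotone S) (T : ℝ) :
    ∀ᵐ t ∂volume.restrict (Ioc 0 T), Summable fun k => w k ^ 2 * majorantLim S Λ m x k t := by
  have hmeas : Measurable fun t => ∑' k, ENNReal.ofReal (w k ^ 2 * majorantLim S Λ m x k t) :=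
    Measurable.tsum fun k => ((measurable_majorantLim h hS k).const_mul _).ennreal_ofReal
  filter_upwards [ae_lt_top hmeas
    ((lintegral_tsum_majorantLim_le h hS T).trans_lt ENNReal.ofReal_lt_top).ne] with t ht
  refine (ENNReal.summable_toReal ht.ne).congr fun k => ?_
  rw [ENNReal.toReal_ofReal (mul_nonneg (sq_nonneg _) (majorantLim_nonneg h hS k t))]

theorem integrableOn_tsum_weight_majorantLim [Countable ι] (h : IsDissipative Λ m w x K κ a)
    (hS : Monotone S) (T : ℝ) :
    IntegrableOn (fun t => ∑' k, w k ^ 2 * majorantLim S Λ m x k t) (Ioc 0 T) := by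
  have hmeas : Measurable fun t => ∑' k, ENNReal.ofReal (w k ^ 2 * majorantLim S Λ m x k t) :=
    Measurable.tsum fun k => ((measurable_majorantLim h hS k).const_mul _).ennreal_ofReal
  refine (integrable_toReal_of_lintegral_ne_top hmeas.aemeasurable
    ((lintegral_tsum_majorantLim_le h hS T).trans_lt ENNReal.ofReal_lt_top).ne).congr ?_
  refine .of_forall fun t => ?_
  simp only
  rw [ENNReal.tsum_toReal_eq fun k => ENNReal.ofReal_ne_top]
  exact tsum_congr fun k =>
    ENNReal.toReal_ofReal (mul_nonneg (sq_nonneg _) (majorantLim_nonneg h hS k t))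

theorem norm_quadratic_le_weight {ι : Type*} [AddCommGroup ι] {𝕜 : Type*} [RCLike 𝕜] {Λ : ι → ℝ}
    {m : ι → ι → ℝ} {w : ι → ℝ} {x : ι → 𝕜} {K κ a : ℝ} {c : ι → 𝕜} {g : ι → ℝ}
    (hc : ∀ k, ‖c k‖ ≤ g k) (h : IsDissipative Λ m w x K κ a) (h0 : Summable g) (ha : ∑' k, g k ≤ a)
    (h2 : Summable fun k => w k ^ 2 * g k) (k : ι) :
    ‖quadratic m c k‖ ≤ κ * (a * ∑' k, w k ^ 2 * g k) := by
  obtain ⟨h3, h4⟩ := summable_norm_quadratic hc h.weight_nonneg h.abs_kernel_le h.κ_nonneg h0 h2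
  refine (h3.le_tsum k fun _ _ => norm_nonneg _).trans (h4.trans ?_)
  refine mul_le_mul_of_nonneg_left (mul_le_mul_of_nonneg_right ha ?_) h.κ_nonneg
  exact tsum_nonneg fun k => mul_nonneg (sq_nonneg _) ((norm_nonneg _).trans (hc k))

/-- Dominated convergence in `j`: the limiting majorant bounds every iterate, and its weighted
moment makes the convolution summable at such a time. -/
theorem tendsto_quadratic_picard (h : IsDissipative Λ m w x K κ a) (hS : Monotone S) (k : ι)
    {t : ℝ} (ht : 0 ≤ t) (h2 : Summable fun k => w k ^ 2 * majorantLim S Λ m x k t) :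
    Tendsto (fun n => quadratic m (fun j => picard S Λ m x n j t) k) atTop
      (𝓝 (quadratic m (fun j => picardLim S Λ m x j t) k)) := by
  have hg := fun k => majorantLim_nonneg h hS k t
  have hb := (summable_kernel_mul h.weight_nonneg hg h.abs_kernel_le
    (summable_majorantLim h hS t) h2).prod_factor k
  refine tendsto_tsum_of_dominated_convergence hb (fun j => ?_) (.of_forall fun n j => ?_)
  · have e : max t 0 = t := max_eq_left ht
    have h1 := tendsto_picard h hS j t
    have h1' := tendsto_picard h hS (k - j) t
    rw [e] at h1 h1'
    exact (h1.mul h1').const_smul _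
  · have hle : ∀ j, ‖picard S Λ m x n j t‖ ≤ majorantLim S Λ m x j t := fun j => by
      have := majorant_le_majorantLim h hS n j t
      rw [max_eq_left ht] at this
      exact (norm_picard_le hS n j ht).trans this
    rw [norm_smul, norm_mul, Real.norm_eq_abs, smul_eq_mul]
    exact mul_le_mul_of_nonneg_left (mul_le_mul (hle _) (hle _) (norm_nonneg _) (hg _))
      (abs_nonneg _)

/-- The limit of the Picard iterates solves the evolution equation in integrated form. -/
theorem picardLim_eq_integral [Countable ι] (h : IsDissipative Λ m w x K κ a) (hS : Monotone S)
    (hS' : ∀ k, ∃ n, k ∈ S n) (k : ι) {T : ℝ} (hT : 0 ≤ T) :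
    IntervalIntegrable (fun t => -Λ k • picardLim S Λ m x k t +
      quadratic m (fun j => picardLim S Λ m x j t) k) volume 0 T ∧
    picardLim S Λ m x k T = x k + ∫ t in (0 : ℝ)..T, (-Λ k • picardLim S Λ m x k t +
      quadratic m (fun j => picardLim S Λ m x j t) k) := by
  have ha := data_bound_nonneg h
  set F : ℕ → ℝ → 𝕜 := fun n t => -Λ k • picard S Λ m x (n + 1) k t +
      quadratic m (fun j => picard S Λ m x n j t) k
  set f : ℝ → 𝕜 := fun t => -Λ k • picardLim S Λ m x k t +
      quadratic m (fun j => picardLim S Λ m x j t) k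
  -- One dominating function for all iterates, integrable in time by the limiting dissipation bound.
  set bound : ℝ → ℝ := fun t => |Λ k| * a + κ * (a * ∑' j, w j ^ 2 * majorantLim S Λ m x j t)
  have hF : ∀ n, Continuous (F n) := fun n =>
    ((continuous_picard hS (n + 1) k).const_smul _).add (continuous_quadratic_picard hS n k)
  have hbound : IntegrableOn bound (Ioc 0 T) :=
    (integrableOn_const (by simp)).add
      (((integrableOn_tsum_weight_majorantLim h hS T).const_mul a).const_mul κ)
  have hFb : ∀ n, ∀ᵐ t ∂volume.restrict (Ioc 0 T), ‖F n t‖ ≤ bound t := by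
    intro n
    filter_upwards [ae_summable_weight_majorantLim h hS T, ae_restrict_mem measurableSet_Ioc]
      with t h2 ht
    have e : max t 0 = t := max_eq_left ht.1.le
    refine (norm_add_le _ _).trans (add_le_add ?_ ?_)
    · rw [norm_smul, norm_neg, Real.norm_eq_abs]
      exact mul_le_mul_of_nonneg_left
        ((norm_picard_le hS _ k ht.1.le).trans (majorant_le h hS _ k ht.1.le)) (abs_nonneg _)
    · refine norm_quadratic_le_weight (fun j => ?_) h (summable_majorantLim h hS t)
        (tsum_majorantLim_le_data h hS t) h2 k
      have := majorant_le_majorantLim h hS n j t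
      rw [e] at this
      exact (norm_picard_le hS n j ht.1.le).trans this
  have hlim : ∀ᵐ t ∂volume.restrict (Ioc 0 T), Tendsto (fun n => F n t) atTop (𝓝 (f t)) := by
    filter_upwards [ae_summable_weight_majorantLim h hS T, ae_restrict_mem measurableSet_Ioc]
      with t h2 ht
    have h1 := (tendsto_picard h hS k t).comp (tendsto_add_atTop_nat 1)
    rw [max_eq_left ht.1.le] at h1
    exact (h1.const_smul _).add (tendsto_quadratic_picard h hS k ht.1.le h2)
  have hint := tendsto_integral_of_dominated_convergence bound
    (fun n => (hF n).aestronglyMeasurable) hbound hFb hlim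
  have hfm : AEStronglyMeasurable f (volume.restrict (Ioc 0 T)) :=
    aestronglyMeasurable_of_tendsto_ae atTop (fun n => (hF n).aestronglyMeasurable) hlim
  have hfb : ∀ᵐ t ∂volume.restrict (Ioc 0 T), ‖f t‖ ≤ bound t := by
    filter_upwards [ae_all_iff.2 hFb, hlim] with t h1 h2
    exact le_of_tendsto' h2.norm h1
  refine ⟨(intervalIntegrable_iff_integrableOn_Ioc_of_le hT).2 (hbound.mono' hfm hfb), ?_⟩
  -- From step `N` on the mode `k` is no longer truncated, so the iterates satisfy the integrated
  -- equation exactly.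
  obtain ⟨N, hN⟩ := hS' k
  have heq : ∀ n ≥ N, picard S Λ m x (n + 1) k T = x k + ∫ t in Ioc 0 T, F n t := by
    intro n hn
    have hk := hS hn hN
    have := intervalIntegral.integral_eq_sub_of_hasDerivAt
      (fun t _ => hasDerivAt_picard (Λ := Λ) (m := m) (x := x) hS hk t)
      ((hF n).intervalIntegrable 0 T)
    rw [← intervalIntegral.integral_of_le hT, this, picard_succ_of_mem hk, duhamel_zero]
    abel
  have h1 := (tendsto_picard h hS k T).comp (tendsto_add_atTop_nat 1)
  rw [max_eq_left hT] at h1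
  rw [intervalIntegral.integral_of_le hT]
  refine tendsto_nhds_unique h1 ((hint.const_add (x k)).congr' ?_)
  filter_upwards [eventually_ge_atTop N] with n hn using (heq n hn).symm

end Limit

/-! ### Conjugation symmetry -/

section Conj

variable {ι : Type*} [AddCommGroup ι] [DecidableEq ι] {S : ℕ → Finset ι} {Λ : ι → ℝ}
  {m : ι → ι → ℝ} {x : ι → ℂ}

theorem quadratic_neg {ι : Type*} [AddCommGroup ι] {m : ι → ι → ℝ} (hm : ∀ j l, m (-j) (-l) = m j l)
    {c : ι → ℂ} (hc : ∀ k, c (-k) = conj (c k)) (k : ι) :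
    quadratic m c (-k) = conj (quadratic m c k) := by
  rw [quadratic, quadratic, Complex.conj_tsum, ← (Equiv.neg ι).tsum_eq]
  refine tsum_congr fun j => ?_
  have e : -k - -j = -(k - j) := by abel
  simp only [Equiv.neg_apply, e, hm, hc, Complex.real_smul, map_mul, Complex.conj_ofReal]

/-- Symmetric truncations, an even rate and an even kernel preserve the symmetry characterizing
Fourier coefficients of real functions. -/
theorem picard_neg (hS : ∀ n k, k ∈ S n → -k ∈ S n) (hΛ : ∀ k, Λ (-k) = Λ k)
    (hm : ∀ j l, m (-j) (-l) = m j l) (hx : ∀ k, x (-k) = conj (x k)) (n : ℕ) (k : ι) (t : ℝ) :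
    picard S Λ m x n (-k) t = conj (picard S Λ m x n k t) := by
  induction n generalizing k t with
  | zero => simp [picard]
  | succ n ih =>
    by_cases hk : k ∈ S n
    · rw [picard_succ_of_mem hk, picard_succ_of_mem (hS n k hk), duhamel, duhamel, hΛ, hx]
      have hq : ∀ s, quadratic m (fun j => picard S Λ m x n j s) (-k) =
          conj (quadratic m (fun j => picard S Λ m x n j s) k) := fun s =>
        quadratic_neg hm (fun k => ih k s) k
      simp only [hq, Complex.real_smul, map_mul, map_add,
        Complex.conj_ofReal, ← intervalIntegral.intervalIntegral_conj]
    · have hk' : -k ∉ S n := fun h => hk (by simpa using hS n _ h)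
      rw [picard_succ_of_notMem hk, picard_succ_of_notMem hk', map_zero]

theorem picardLim_neg {w : ι → ℝ} {K κ a : ℝ} (h : IsDissipative Λ m w x K κ a) (hSm : Monotone S)
    (hS : ∀ n k, k ∈ S n → -k ∈ S n) (hΛ : ∀ k, Λ (-k) = Λ k)
    (hm : ∀ j l, m (-j) (-l) = m j l) (hx : ∀ k, x (-k) = conj (x k)) (k : ι) (t : ℝ) :
    picardLim S Λ m x (-k) t = conj (picardLim S Λ m x k t) := by
  refine tendsto_nhds_unique (tendsto_picard h hSm (-k) t) ?_
  simp only [picard_neg hS hΛ hm hx]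
  exact (Complex.continuous_conj.tendsto _).comp (tendsto_picard h hSm k t)

end Conj

/-! ### Characters of the torus -/

theorem continuous_character (k : Fin 2 → ℤ) : Continuous (character k) := by
  unfold character
  fun_prop

theorem norm_character (k : Fin 2 → ℤ) (x : Torus) : ‖character k x‖ = 1 := by
  simp only [character, norm_prod, fourier_apply, Circle.norm_coe, Finset.prod_const_one]

theorem character_zero (x : Torus) : character 0 x = 1 := by simp [character]

theorem character_add_index (k l : Fin 2 → ℤ) (x : Torus) :
    character (k + l) x = character k x * character l x := by
  simp only [character, Pi.add_apply, fourier_add, Finset.prod_mul_distrib]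

theorem character_neg (k : Fin 2 → ℤ) (x : Torus) : character (-k) x = conj (character k x) := by
  simp only [character, Pi.neg_apply, fourier_neg, map_prod]

theorem character_add (k : Fin 2 → ℤ) (x y : Torus) :
    character k (x + y) = character k x * character k y := by
  simp only [character, Pi.add_apply, fourier_apply, smul_add, AddCircle.toCircle_add,
    Circle.coe_mul, Finset.prod_mul_distrib]

theorem fourier_coe_two_pi (n : ℤ) (s : ℝ) :
    fourier n (s : AddCircle (2 * π)) = Complex.exp (Complex.I * n * s) := by
  rw [fourier_coe_apply]
  congr 1
  have : (π : ℂ) ≠ 0 := by exact_mod_cast Real.pi_ne_zero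
  push_cast
  field_simp

theorem character_single (k : Fin 2 → ℤ) (j : Fin 2) (s : ℝ) :
    character k (Pi.single j (s : AddCircle (2 * π))) = Complex.exp (Complex.I * k j * s) := by
  rw [character, Finset.prod_eq_single j, Pi.single_eq_same, fourier_coe_two_pi]
  · intro i _ hi
    rw [Pi.single_eq_of_ne hi, fourier_eval_zero]
  · simp

theorem character_coe (k : Fin 2 → ℤ) (y : Fin 2 → ℝ) :
    character k (fun j => (y j : AddCircle (2 * π))) =
      ∏ j, Complex.exp (Complex.I * k j * y j) := by
  simp only [character, fourier_coe_two_pi]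

theorem volume_torus : (volume : Measure Torus).real univ = (2 * π) ^ 2 := by
  rw [measureReal_def, volume_pi, Measure.pi_univ]
  simp [AddCircle.measure_univ, Real.pi_pos.le, sq]

theorem integrable_mul_character {f : Torus → ℂ} (hf : Integrable f) (k : Fin 2 → ℤ) :
    Integrable fun x => character k x * f x :=
  hf.bdd_mul (c := 1) (continuous_character k).aestronglyMeasurable
    (.of_forall fun x => (norm_character k x).le)

theorem integral_character (k : Fin 2 → ℤ) :
    ∫ x, character k x = if k = 0 then (2 * (π : ℂ)) ^ 2 else 0 := by
  split_ifs with hk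
  · subst hk
    simp only [character_zero, integral_const, volume_torus]
    simp
  · obtain ⟨j, hj⟩ := Function.ne_iff.1 hk
    have hj : k j ≠ 0 := hj
    -- Translation by `π / kⱼ` along axis `j` multiplies the character by `-1`, so its integral
    -- equals its own negative.
    have h1 := integral_add_right_eq_self (μ := (volume : Measure Torus)) (character k)
      (Pi.single j ((π / k j : ℝ) : AddCircle (2 * π)))
    simp only [character_add, character_single, integral_mul_const] at h1
    have e : Complex.I * k j * ((π / k j : ℝ) : ℂ) = π * Complex.I := by
      have : (k j : ℂ) ≠ 0 := by exact_mod_cast hj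
      push_cast
      field_simp
    rw [e, Complex.exp_pi_mul_I] at h1
    have h2 : (2 : ℂ) * ∫ x, character k x = 0 := by linear_combination -h1
    simpa using h2

/-! ### Absolutely convergent Fourier series -/

/-- The Fourier series with coefficients `a`. -/
def series (a : (Fin 2 → ℤ) → ℂ) (x : Torus) : ℂ := ∑' k, a k * character k x

section Series

variable {a b : (Fin 2 → ℤ) → ℂ}

theorem norm_mul_character (a : (Fin 2 → ℤ) → ℂ) (k : Fin 2 → ℤ) (x : Torus) :
    ‖a k * character k x‖ = ‖a k‖ := by rw [norm_mul, norm_character, mul_one]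

theorem hasSum_series (ha : Summable fun k => ‖a k‖) (x : Torus) :
    HasSum (fun k => a k * character k x) (series a x) :=
  (Summable.of_norm (by simpa only [norm_mul_character] using ha)).hasSum

theorem continuous_series (ha : Summable fun k => ‖a k‖) : Continuous (series a) :=
  continuous_tsum (fun k => continuous_const.mul (continuous_character k)) ha
    fun k x => (norm_mul_character a k x).le

theorem norm_series_le (ha : Summable fun k => ‖a k‖) (x : Torus) :
    ‖series a x‖ ≤ ∑' k, ‖a k‖ :=
  tsum_of_norm_bounded ha.hasSum fun k => (norm_mul_character a k x).le

theorem conj_series (ha : ∀ k, a (-k) = conj (a k)) (x : Torus) :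
    conj (series a x) = series a x := by
  rw [series, Complex.conj_tsum, ← (Equiv.neg _).tsum_eq]
  refine tsum_congr fun k => ?_
  rw [Equiv.neg_apply, map_mul, ← ha, neg_neg, character_neg, Complex.conj_conj]

theorem ofReal_re_series (ha : ∀ k, a (-k) = conj (a k)) (x : Torus) :
    ((series a x).re : ℂ) = series a x :=
  Complex.conj_eq_iff_re.1 (conj_series ha x)

/-- Parseval pairing of `A⁰` with `L¹`: the terms have `L¹` norms `‖aₖ‖ ∫‖f‖`, so termwise
integration needs nothing more of `f`. It is the bridge between modes and integrals throughout. -/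
theorem hasSum_integral_series_mul (ha : Summable fun k => ‖a k‖) {f : Torus → ℂ}
    (hf : Integrable f) :
    HasSum (fun k => a k * ∫ x, character k x * f x) (∫ x, series a x * f x) := by
  have h := hasSum_integral_of_summable_integral_norm (μ := (volume : Measure Torus))
    (F := fun k x => a k * (character k x * f x))
    (fun k => (integrable_mul_character hf k).const_mul _) ?_
  · simp only [integral_const_mul] at h
    have e : ∀ x, series a x * f x = ∑' k, a k * (character k x * f x) := fun x => by
      simp only [← mul_assoc]
      rw [series, tsum_mul_right]
    simpa only [e] using h
  · simp only [norm_mul, norm_character, one_mul, integral_const_mul]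
    exact ha.mul_right _

theorem integrable_series (ha : Summable fun k => ‖a k‖) : Integrable (series a) :=
  .of_bound (continuous_series ha).aestronglyMeasurable _ (.of_forall (norm_series_le ha))

theorem coeff_series (ha : Summable fun k => ‖a k‖) (hc : ∀ k, a (-k) = conj (a k))
    (k : Fin 2 → ℤ) : coeff (fun x => (series a x).re) k = a k := by
  have hk : Integrable (character (-k)) :=
    .of_bound (continuous_character _).aestronglyMeasurable 1
      (.of_forall fun x => (norm_character _ x).le)
  have h := hasSum_integral_series_mul ha hk
  have e : ∀ j, a j * ∫ x, character j x * character (-k) x =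
      if j = k then a k * (2 * (π : ℂ)) ^ 2 else 0 := by
    intro j
    simp only [← character_add_index, integral_character, ← sub_eq_add_neg, sub_eq_zero]
    split_ifs with h
    · rw [h]
    · simp
  simp only [e] at h
  have h2 := h.unique (hasSum_ite_eq k _)
  have hπ : (2 * (π : ℂ)) ^ 2 ≠ 0 := by
    have : (π : ℂ) ≠ 0 := by exact_mod_cast Real.pi_ne_zero
    exact pow_ne_zero 2 (mul_ne_zero two_ne_zero this)
  simp only [coeff, ofReal_re_series hc]
  rw [h2]
  field_simp

theorem series_mul_series (ha : Summable fun k => ‖a k‖) (hb : Summable fun k => ‖b k‖)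
    (x : Torus) :
    HasSum (fun k => (∑' j, a j * b (k - j)) * character k x) (series a x * series b x) := by
  have h := hasSum_convolution (f := fun k => a k * character k x)
    (g := fun k => b k * character k x) (by simpa only [norm_mul_character] using ha)
    (by simpa only [norm_mul_character] using hb)
  refine h.congr_fun fun k => ?_
  rw [← tsum_mul_right]
  refine tsum_congr fun j => ?_
  have : character k x = character j x * character (k - j) x := by
    rw [← character_add_index, add_sub_cancel]
  rw [this]
  ring

end Series

/-! ### Smooth functions on the torus -/

/-- The covering map `ℝ² → 𝕋²`. -/
def toTorus (y : Fin 2 → ℝ) : Torus := fun j => (y j : AddCircle (2 * π))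

theorem isOpenQuotientMap_toTorus : IsOpenQuotientMap toTorus :=
  IsOpenQuotientMap.piMap fun _ => QuotientAddGroup.isOpenQuotientMap_mk

theorem toTorus_add_smul_single (y : Fin 2 → ℝ) (j : Fin 2) (s : ℝ) :
    toTorus (y + s • Pi.single j 1) = toTorus y + Pi.single j (s : AddCircle (2 * π)) := by
  ext i
  rcases eq_or_ne i j with rfl | h
  · simp [toTorus]
  · simp [toTorus, h]

theorem partialDeriv_toTorus {ζ : Torus → ℝ} (hζ : IsSmooth ζ) (j : Fin 2) (y : Fin 2 → ℝ) :
    partialDeriv j ζ (toTorus y) =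
      fderiv ℝ (fun y => ζ (toTorus y)) y (Pi.single j 1) := by
  have hd : DifferentiableAt ℝ (fun y => ζ (toTorus y)) y :=
    (ContDiff.differentiable hζ (by simp)) y
  rw [← hd.lineDeriv_eq_fderiv]
  simp only [lineDeriv, partialDeriv, toTorus_add_smul_single]

theorem IsSmooth.partialDeriv {ζ : Torus → ℝ} (hζ : IsSmooth ζ) (j : Fin 2) :
    IsSmooth (partialDeriv j ζ) := by
  have : ContDiff ℝ (⊤ : ℕ∞) fun y => fderiv ℝ (fun y => ζ (toTorus y)) y (Pi.single j 1) :=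
    (ContDiff.fderiv_right (m := (⊤ : ℕ∞)) hζ (by simp)).clm_apply contDiff_const
  simp only [← partialDeriv_toTorus hζ] at this
  exact this

theorem IsSmooth.iterate_partialDeriv {ζ : Torus → ℝ} (hζ : IsSmooth ζ) (j : Fin 2) (n : ℕ) :
    IsSmooth ((HessianFlow.partialDeriv j)^[n] ζ) := by
  induction n with
  | zero => exact hζ
  | succ n ih => rw [Function.iterate_succ_apply']; exact ih.partialDeriv j

theorem IsSmooth.continuous {ζ : Torus → ℝ} (hζ : IsSmooth ζ) : Continuous ζ :=
  isOpenQuotientMap_toTorus.isQuotientMap.continuous_iff.2 (ContDiff.continuous hζ)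

theorem IsSmooth.exists_bound {ζ : Torus → ℝ} (hζ : IsSmooth ζ) : ∃ C, ∀ x, ‖ζ x‖ ≤ C := by
  obtain ⟨C, hC⟩ := isCompact_univ.exists_bound_of_continuousOn hζ.continuous.continuousOn
  exact ⟨C, fun x => hC x (mem_univ x)⟩

theorem IsSmooth.integrable {ζ : Torus → ℝ} (hζ : IsSmooth ζ) : Integrable ζ := by
  obtain ⟨C, hC⟩ := hζ.exists_bound
  exact .of_bound hζ.continuous.aestronglyMeasurable C (.of_forall hC)

theorem IsSmooth.hasDerivAt {ζ : Torus → ℝ} (hζ : IsSmooth ζ) (j : Fin 2) (x : Torus) (s : ℝ) :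
    HasDerivAt (fun s : ℝ => ζ (x + Pi.single j (s : AddCircle (2 * π))))
      (HessianFlow.partialDeriv j ζ (x + Pi.single j (s : AddCircle (2 * π)))) s := by
  obtain ⟨y, rfl⟩ := isOpenQuotientMap_toTorus.surjective x
  simp only [← toTorus_add_smul_single]
  rw [partialDeriv_toTorus hζ]
  have hd : HasFDerivAt (fun y => ζ (toTorus y))
      (fderiv ℝ (fun y => ζ (toTorus y)) (y + s • Pi.single j 1)) (y + s • Pi.single j 1) :=
    ((ContDiff.differentiable hζ (by simp)) _).hasFDerivAt
  have hl : HasDerivAt (fun s : ℝ => y + s • (Pi.single j 1 : Fin 2 → ℝ)) (Pi.single j 1) s := by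
    simpa using ((hasDerivAt_id s).smul_const (Pi.single j 1 : Fin 2 → ℝ)).const_add y
  exact hd.comp_hasDerivAt s hl

theorem integrable_ofReal {f : Torus → ℝ} (hf : Integrable f) : Integrable fun x => (f x : ℂ) :=
  hf.ofReal

theorem hasDerivAt_exp_mul (z : ℂ) : HasDerivAt (fun s : ℝ => Complex.exp (z * s)) z 0 := by
  have : HasDerivAt (fun s : ℝ => z * (s : ℂ)) z 0 := by
    simpa using (Complex.ofRealCLM.hasDerivAt (x := (0 : ℝ))).const_mul z
  simpa using this.cexp

/-- Invariance of the measure moves the translation onto the character, where it becomes a scalar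
exponential. Differentiating in `s` at `0` gives integration by parts without boundary terms. -/
theorem integral_character_mul_translate (ζ : Torus → ℝ) (j : Fin 2) (k : Fin 2 → ℤ) (s : ℝ) :
    ∫ x : Torus, character k x * (ζ (x + Pi.single j (s : AddCircle (2 * π))) : ℂ) =
      Complex.exp (-(Complex.I * k j) * s) * ∫ x, character k x * (ζ x : ℂ) := by
  rw [← integral_add_right_eq_self (μ := (volume : Measure Torus))
    (fun x : Torus => character k x * (ζ x : ℂ)) (Pi.single j (s : AddCircle (2 * π))),
    ← integral_const_mul]
  refine integral_congr_ae (.of_forall fun x => ?_)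
  simp only [character_add, character_single]
  have : Complex.exp (-(Complex.I * k j) * s) * Complex.exp (Complex.I * k j * s) = 1 := by
    rw [← Complex.exp_add]
    simp
  linear_combination (-character k x * (ζ (x + Pi.single j (s : AddCircle (2 * π))) : ℂ)) * this

theorem hasDerivAt_integral_of_bounded_deriv {F F' : ℝ → Torus → ℂ} {C : ℝ}
    (hF : ∀ s, Continuous (F s)) (hF' : ∀ s, Continuous (F' s)) (hb : ∀ s x, ‖F' s x‖ ≤ C)
    (hd : ∀ x s, HasDerivAt (fun s => F s x) (F' s x) s) :
    HasDerivAt (fun s : ℝ => ∫ x : Torus, F s x) (∫ x : Torus, F' 0 x) 0 := by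
  have hint : Integrable (F 0) := by
    obtain ⟨B, hB⟩ := isCompact_univ.exists_bound_of_continuousOn (hF 0).continuousOn
    exact .of_bound (hF 0).aestronglyMeasurable B (.of_forall fun x => hB x (mem_univ x))
  refine (hasDerivAt_integral_of_dominated_loc_of_deriv_le (F' := F') (bound := fun _ => C)
    (s := univ) univ_mem ?_ hint ?_ ?_ ?_ ?_).2
  · exact .of_forall fun s => (hF s).aestronglyMeasurable
  · exact (hF' 0).aestronglyMeasurable
  · exact .of_forall fun x s _ => hb s x
  · exact integrable_const C
  · exact .of_forall fun x s _ => hd x s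

theorem IsSmooth.continuous_character_mul_translate {ζ : Torus → ℝ} (hζ : IsSmooth ζ)
    (k : Fin 2 → ℤ) (y : Torus) : Continuous fun x : Torus => character k x * (ζ (x + y) : ℂ) :=
  (continuous_character k).mul (Complex.continuous_ofReal.comp
    (hζ.continuous.comp (continuous_id.add continuous_const)))

theorem hasDerivAt_integral_translate {ζ : Torus → ℝ} (hζ : IsSmooth ζ) (j : Fin 2)
    (k : Fin 2 → ℤ) :
    HasDerivAt (fun s : ℝ => ∫ x : Torus,
        character k x * (ζ (x + Pi.single j (s : AddCircle (2 * π))) : ℂ))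
      (∫ x : Torus, character k x *
        (partialDeriv j ζ (x + Pi.single j ((0 : ℝ) : AddCircle (2 * π))) : ℂ)) 0 := by
  obtain ⟨C, hC⟩ := (hζ.partialDeriv j).exists_bound
  have hF : ∀ s : ℝ, Continuous fun x : Torus =>
      character k x * (ζ (x + Pi.single j (s : AddCircle (2 * π))) : ℂ) :=
    fun s => hζ.continuous_character_mul_translate k _
  have hF' : ∀ s : ℝ, Continuous fun x : Torus =>
      character k x * (partialDeriv j ζ (x + Pi.single j (s : AddCircle (2 * π))) : ℂ) :=
    fun s => (hζ.partialDeriv j).continuous_character_mul_translate k _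
  have hb : ∀ (s : ℝ) (x : Torus), ‖character k x *
      (partialDeriv j ζ (x + Pi.single j (s : AddCircle (2 * π))) : ℂ)‖ ≤ C := fun s x => by
    rw [norm_mul, norm_character, one_mul, Complex.norm_real]
    exact hC _
  have hd : ∀ (x : Torus) (s : ℝ), HasDerivAt
      (fun s : ℝ => character k x * (ζ (x + Pi.single j (s : AddCircle (2 * π))) : ℂ))
      (character k x * (partialDeriv j ζ (x + Pi.single j (s : AddCircle (2 * π))) : ℂ)) s :=
    fun x s => ((hζ.hasDerivAt j x s).ofReal_comp).const_mul _
  have h := hasDerivAt_integral_of_bounded_deriv hF hF' hb hd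
  exact h

/-- Integration by parts against a character. -/
theorem integral_character_mul_partialDeriv {ζ : Torus → ℝ} (hζ : IsSmooth ζ) (j : Fin 2)
    (k : Fin 2 → ℤ) :
    ∫ x, character k x * (partialDeriv j ζ x : ℂ) =
      -(Complex.I * k j) * ∫ x, character k x * (ζ x : ℂ) := by
  have h1 := hasDerivAt_integral_translate hζ j k
  simp only [integral_character_mul_translate] at h1
  have h2 := h1.unique ((hasDerivAt_exp_mul (-(Complex.I * k j))).mul_const _)
  simpa using h2

/-- The Fourier symbol `(ik)^α` of `D^α`. -/
def symbol (α : Fin 2 → ℕ) (k : Fin 2 → ℤ) : ℂ :=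
  (Complex.I * k 0) ^ α 0 * (Complex.I * k 1) ^ α 1

theorem integral_character_mul_iterate {ζ : Torus → ℝ} (hζ : IsSmooth ζ) (j : Fin 2) (n : ℕ)
    (k : Fin 2 → ℤ) :
    ∫ x, character k x * ((partialDeriv j)^[n] ζ x : ℂ) =
      (-(Complex.I * k j)) ^ n * ∫ x, character k x * (ζ x : ℂ) := by
  induction n with
  | zero => simp
  | succ n ih =>
    rw [Function.iterate_succ_apply', integral_character_mul_partialDeriv
      (hζ.iterate_partialDeriv j n), ih]
    ring

theorem integral_character_mul_classicalDeriv {ζ : Torus → ℝ} (hζ : IsSmooth ζ) (α : Fin 2 → ℕ)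
    (k : Fin 2 → ℤ) :
    ∫ x, character k x * (classicalDeriv α ζ x : ℂ) =
      (-1) ^ (α 0 + α 1) * symbol α k * ∫ x, character k x * (ζ x : ℂ) := by
  rw [classicalDeriv, integral_character_mul_iterate (hζ.iterate_partialDeriv 1 _),
    integral_character_mul_iterate hζ, symbol, neg_pow, neg_pow (Complex.I * k 1), pow_add]
  ring

theorem IsSmooth.classicalDeriv {ζ : Torus → ℝ} (hζ : IsSmooth ζ) (α : Fin 2 → ℕ) :
    IsSmooth (classicalDeriv α ζ) :=
  (hζ.iterate_partialDeriv 1 _).iterate_partialDeriv 0 _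

/-! ### Weak derivatives of Fourier series -/

theorem symbol_neg (α : Fin 2 → ℕ) (k : Fin 2 → ℤ) : symbol α (-k) = conj (symbol α k) := by
  simp [symbol]

/-- Both sides of the defining identity are Parseval sums, and they agree mode by mode. -/
theorem isWeakDeriv_series {a : (Fin 2 → ℤ) → ℂ} (ha : Summable fun k => ‖a k‖)
    (hc : ∀ k, a (-k) = conj (a k)) (α : Fin 2 → ℕ) (hα : Summable fun k => ‖symbol α k * a k‖) :
    IsWeakDeriv α (fun x => (series a x).re)
      (fun x => (series (fun k => symbol α k * a k) x).re) := by
  refine ⟨(integrable_series ha).re, (integrable_series hα).re, fun ζ hζ => ?_⟩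
  have hcα : ∀ k, symbol α (-k) * a (-k) = conj (symbol α k * a k) := fun k => by
    rw [symbol_neg, hc, map_mul]
  have h1 := hasSum_integral_series_mul ha (integrable_ofReal (hζ.classicalDeriv α).integrable)
  have h2 := (hasSum_integral_series_mul hα (integrable_ofReal hζ.integrable)).mul_left
    ((-1) ^ (α 0 + α 1))
  have h3 := h1.unique (h2.congr_fun fun k => by
    rw [integral_character_mul_classicalDeriv hζ]
    ring)
  apply Complex.ofReal_injective
  push_cast
  rw [← integral_complex_ofReal, ← integral_complex_ofReal]
  push_cast
  simp only [ofReal_re_series hc,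
    ofReal_re_series (a := fun k => symbol α k * a k) hcα]
  exact h3

theorem isSmooth_re_character (k : Fin 2 → ℤ) (z : ℂ) :
    IsSmooth fun x => (z * character k x).re := by
  unfold IsSmooth
  simp only [character_coe]
  have : ContDiff ℝ (⊤ : ℕ∞) fun y : Fin 2 → ℝ =>
      z * ∏ j, Complex.exp (Complex.I * k j * y j) := by
    refine contDiff_const.mul (contDiff_prod fun j _ => ContDiff.cexp ?_)
    exact contDiff_const.mul (Complex.ofRealCLM.contDiff.comp (contDiff_apply ℝ ℝ j))
  exact Complex.reCLM.contDiff.comp this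

theorem partialDeriv_re_character (k : Fin 2 → ℤ) (z : ℂ) (j : Fin 2) :
    partialDeriv j (fun x => (z * character k x).re) =
      fun x => ((Complex.I * k j * z) * character k x).re := by
  ext x
  unfold partialDeriv
  simp only [character_add, character_single]
  have h2 := Complex.reCLM.hasFDerivAt.comp_hasDerivAt 0
    (((hasDerivAt_exp_mul (Complex.I * k j)).const_mul (character k x)).const_mul z)
  rw [show (fun s : ℝ => (z * (character k x * Complex.exp (Complex.I * k j * (s : ℂ)))).re) =
    ⇑Complex.reCLM ∘ fun s : ℝ => z * (character k x * Complex.exp (Complex.I * k j * (s : ℂ)))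
    from rfl, h2.deriv]
  simp only [Complex.reCLM_apply]
  congr 1
  ring

theorem classicalDeriv_re_character (k : Fin 2 → ℤ) (z : ℂ) (α : Fin 2 → ℕ) :
    classicalDeriv α (fun x => (z * character k x).re) =
      fun x => ((symbol α k * z) * character k x).re := by
  have h : ∀ (j : Fin 2) (n : ℕ) (z : ℂ), (partialDeriv j)^[n] (fun x => (z * character k x).re) =
      fun x => (((Complex.I * k j) ^ n * z) * character k x).re := by
    intro j n
    induction n with
    | zero => simp
    | succ n ih =>
      intro z
      rw [Function.iterate_succ_apply, partialDeriv_re_character, ih]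
      ext x
      congr 2
      ring
  rw [classicalDeriv, h, h]
  simp only [symbol, mul_assoc]

/-- Only real test functions are admissible, so the definition is tested on the real part of `z`
times the character; `z = 1` and `z = -i` recover the real and imaginary parts. -/
theorem IsWeakDeriv.integral_character_mul {α : Fin 2 → ℕ} {f v : Torus → ℝ}
    (h : IsWeakDeriv α f v) (k : Fin 2 → ℤ) :
    ∫ x, character k x * (v x : ℂ) =
      (-1) ^ (α 0 + α 1) * symbol α k * ∫ x, character k x * (f x : ℂ) := by
  obtain ⟨hf, hv, h⟩ := h
  have hre : ∀ {g : Torus → ℝ}, Integrable g → ∀ z : ℂ,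
      (z * ∫ x, character k x * (g x : ℂ)).re = ∫ x, g x * (z * character k x).re := by
    intro g hg z
    rw [← integral_const_mul, ← Complex.reCLM_apply, ← Complex.reCLM.integral_comp_comm
      ((integrable_mul_character (integrable_ofReal hg) k).const_mul z)]
    refine integral_congr_ae (.of_forall fun x => ?_)
    simp only [Complex.reCLM_apply]
    rw [← mul_assoc, Complex.re_mul_ofReal, mul_comm]
  have key : ∀ z : ℂ, (z * ∫ x, character k x * (v x : ℂ)).re =
      (z * ((-1) ^ (α 0 + α 1) * symbol α k * ∫ x, character k x * (f x : ℂ))).re := by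
    intro z
    have h1 := h _ (isSmooth_re_character k z)
    rw [classicalDeriv_re_character, ← hre hf, ← hre hv] at h1
    have e : z * ((-1) ^ (α 0 + α 1) * symbol α k * ∫ x, character k x * (f x : ℂ)) =
        (((-1) ^ (α 0 + α 1) : ℝ) : ℂ) *
          (symbol α k * z * ∫ x, character k x * (f x : ℂ)) := by
      push_cast
      ring
    rw [e, Complex.re_ofReal_mul, h1, ← mul_assoc, ← pow_add, ← two_mul, pow_mul]
    simp
  apply Complex.ext
  · simpa using key 1
  · have := key (-Complex.I)
    simp only [neg_mul, Complex.neg_re, Complex.I_mul_re, neg_neg] at this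
    exact this

/-! ### Uniqueness of Fourier coefficients of integrable functions -/

/-- The characters as continuous maps. -/
def characterMap (k : Fin 2 → ℤ) : C(Torus, ℂ) := ⟨character k, continuous_character k⟩

/-- The star subalgebra generated by the characters. -/
def characterSubalgebra : StarSubalgebra ℂ C(Torus, ℂ) where
  toSubalgebra := Algebra.adjoin ℂ (range characterMap)
  star_mem' := by
    change Algebra.adjoin ℂ (range characterMap) ≤ star (Algebra.adjoin ℂ (range characterMap))
    refine Algebra.adjoin_le ?_
    rintro _ ⟨k, rfl⟩
    refine Algebra.subset_adjoin ⟨-k, ?_⟩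
    ext1 x
    simp [characterMap, character_neg]

theorem characterSubalgebra_coe :
    Subalgebra.toSubmodule characterSubalgebra.toSubalgebra =
      Submodule.span ℂ (range characterMap) := by
  apply Algebra.adjoin_eq_span_of_subset
  refine .trans (fun x ↦ Submonoid.closure_induction (fun _ ↦ id) ⟨0, ?_⟩ ?_)
    Submodule.subset_span
  · ext x
    simp [characterMap, character_zero]
  · rintro _ _ _ _ ⟨k, rfl⟩ ⟨l, rfl⟩
    exact ⟨k + l, by ext x; simp [characterMap, character_add_index]⟩

theorem characterSubalgebra_separatesPoints : characterSubalgebra.SeparatesPoints := by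
  intro x y hxy
  obtain ⟨i, hi⟩ := Function.ne_iff.1 hxy
  refine ⟨_, ⟨characterMap (Pi.single i 1), Algebra.subset_adjoin ⟨_, rfl⟩, rfl⟩, ?_⟩
  have h : ∀ z : Torus, character (Pi.single i 1) z = AddCircle.toCircle (z i) := by
    intro z
    rw [character, Finset.prod_eq_single i, Pi.single_eq_same, fourier_one]
    · intro j _ hj
      rw [Pi.single_eq_of_ne hj, fourier_zero]
    · simp
  simp only [characterMap, ContinuousMap.coe_mk, h]
  intro h'
  exact hi (AddCircle.injective_toCircle Real.two_pi_pos.ne' (Subtype.coe_injective h'))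

theorem span_characterMap_closure_eq_top :
    (Submodule.span ℂ (range characterMap)).topologicalClosure = ⊤ := by
  rw [← characterSubalgebra_coe]
  exact congr_arg (Subalgebra.toSubmodule <| StarSubalgebra.toSubalgebra ·)
    (ContinuousMap.starSubalgebra_topologicalClosure_eq_top_of_separatesPoints _
      characterSubalgebra_separatesPoints)

/-- Pairing with `f` is a continuous functional of `g`, bounded by the `L¹` norm of `f`, and the
characters span a dense subspace by Stone–Weierstrass. -/
theorem integral_mul_continuousMap_eq_zero {f : Torus → ℝ} (hf : Integrable f)
    (h : ∀ k, ∫ x, character k x * (f x : ℂ) = 0) (g : C(Torus, ℂ)) :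
    ∫ x, g x * (f x : ℂ) = 0 := by
  have hint : ∀ g : C(Torus, ℂ), Integrable fun x => g x * (f x : ℂ) := fun g =>
    (integrable_ofReal hf).bdd_mul (c := ‖g‖) g.continuous.aestronglyMeasurable
      (.of_forall fun x => g.norm_coe_le_norm x)
  let L : C(Torus, ℂ) →ₗ[ℂ] ℂ :=
    { toFun := fun g => ∫ x, g x * (f x : ℂ)
      map_add' := fun g₁ g₂ => by
        simp only [ContinuousMap.add_apply, add_mul]
        exact integral_add (hint g₁) (hint g₂)
      map_smul' := fun c g => by
        simp only [ContinuousMap.smul_apply, smul_eq_mul, mul_assoc, integral_const_mul,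
          RingHom.id_apply] }
  let L' : C(Torus, ℂ) →L[ℂ] ℂ := L.mkContinuous (∫ x, ‖f x‖) fun g => by
    rw [mul_comm (∫ x, ‖f x‖), ← integral_const_mul]
    refine norm_integral_le_of_norm_le (hf.norm.const_mul _) (.of_forall fun x => ?_)
    rw [norm_mul, Complex.norm_real]
    exact mul_le_mul_of_nonneg_right (g.norm_coe_le_norm x) (norm_nonneg _)
  have hker : (Submodule.span ℂ (range characterMap)).topologicalClosure ≤
      LinearMap.ker L'.toLinearMap := by
    refine Submodule.topologicalClosure_minimal _ (Submodule.span_le.2 ?_) L'.isClosed_ker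
    rintro _ ⟨k, rfl⟩
    exact h k
  rw [span_characterMap_closure_eq_top] at hker
  exact hker (Submodule.mem_top (x := g))

/-- The positive and negative parts of `f` are densities of two finite measures with the same
integrals of bounded continuous functions. The measures coincide, so `f⁺ = f⁻` almost everywhere. -/
theorem ae_eq_zero_of_integral_character_eq_zero {f : Torus → ℝ} (hf : Integrable f)
    (h : ∀ k, ∫ x, character k x * (f x : ℂ) = 0) : f =ᵐ[volume] 0 := by
  have hreal : ∀ g : BoundedContinuousFunction Torus ℝ, ∫ x, g x * f x = 0 := by
    intro g
    have h1 := integral_mul_continuousMap_eq_zero hf h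
      ⟨fun x => (g x : ℂ), Complex.continuous_ofReal.comp g.continuous⟩
    simp only [ContinuousMap.coe_mk, ← Complex.ofReal_mul] at h1
    rw [integral_complex_ofReal] at h1
    exact_mod_cast h1
  set p : Torus → ℝ≥0∞ := fun x => ENNReal.ofReal (f x)
  set q : Torus → ℝ≥0∞ := fun x => ENNReal.ofReal (-f x)
  have hp : AEMeasurable p := hf.aemeasurable.ennreal_ofReal
  have hq : AEMeasurable q := hf.neg.aemeasurable.ennreal_ofReal
  have hp' : ∫⁻ x, p x ≠ ∞ := hf.lintegral_lt_top.ne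
  have hq' : ∫⁻ x, q x ≠ ∞ := hf.neg.lintegral_lt_top.ne
  have := isFiniteMeasure_withDensity hp'
  have := isFiniteMeasure_withDensity hq'
  have hμ : (volume : Measure Torus).withDensity p = volume.withDensity q := by
    refine ext_of_forall_integral_eq_of_IsFiniteMeasure fun g => ?_
    rw [integral_withDensity_eq_integral_toReal_smul₀ hp (by simp [p]),
      integral_withDensity_eq_integral_toReal_smul₀ hq (by simp [q]), ← sub_eq_zero,
      ← integral_sub, ← hreal g]
    · refine integral_congr_ae (.of_forall fun x => ?_)
      simp only [p, q, ENNReal.toReal_ofReal', smul_eq_mul]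
      rcases le_total 0 (f x) with h0 | h0
      · rw [max_eq_left h0, max_eq_right (neg_nonpos.2 h0)]
        ring
      · rw [max_eq_right h0, max_eq_left (neg_nonneg.2 h0)]
        ring
    · simp only [smul_eq_mul, mul_comm _ (g _)]
      exact (integrable_toReal_of_lintegral_ne_top hp hp').bdd_mul (c := ‖g‖)
        g.continuous.aestronglyMeasurable (.of_forall fun x => g.norm_coe_le_norm x)
    · simp only [smul_eq_mul, mul_comm _ (g _)]
      exact (integrable_toReal_of_lintegral_ne_top hq hq').bdd_mul (c := ‖g‖)
        g.continuous.aestronglyMeasurable (.of_forall fun x => g.norm_coe_le_norm x)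
  have hpq := (withDensity_eq_iff hp hq hp').1 hμ
  filter_upwards [hpq] with x hx
  simp only [p, q] at hx
  rcases le_total 0 (f x) with h0 | h0
  · rw [ENNReal.ofReal_of_nonpos (neg_nonpos.2 h0)] at hx
    exact le_antisymm (ENNReal.ofReal_eq_zero.1 hx) h0
  · rw [ENNReal.ofReal_of_nonpos h0] at hx
    exact le_antisymm h0 (by simpa using ENNReal.ofReal_eq_zero.1 hx.symm)

theorem coeff_neg (f : Torus → ℝ) (k : Fin 2 → ℤ) : coeff f (-k) = conj (coeff f k) := by
  rw [coeff, coeff, map_mul, ← integral_conj]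
  simp [character_neg, map_ofNat]

theorem integral_character_mul_eq_coeff (f : Torus → ℝ) (k : Fin 2 → ℤ) :
    ∫ x, character k x * (f x : ℂ) = (2 * (π : ℂ)) ^ 2 * coeff f (-k) := by
  have hπ : (π : ℂ) ≠ 0 := by exact_mod_cast Real.pi_ne_zero
  rw [coeff, neg_neg]
  simp only [mul_comm (character k _)]
  field_simp

/-- An integrable function with absolutely summable Fourier coefficients is the sum of its Fourier
series. -/
theorem ae_eq_series_coeff {f : Torus → ℝ} (hf : Integrable f)
    (hs : Summable fun k => ‖coeff f k‖) : f =ᵐ[volume] fun x => (series (coeff f) x).re := by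
  have hi : Integrable fun x => (series (coeff f) x).re := (integrable_series hs).re
  have h := ae_eq_zero_of_integral_character_eq_zero (hf.sub hi) fun k => ?_
  · filter_upwards [h] with x hx
    simpa [sub_eq_zero] using hx
  · simp only [Pi.sub_apply, Complex.ofReal_sub, mul_sub]
    rw [integral_sub (integrable_mul_character (integrable_ofReal hf) k)
      (integrable_mul_character (integrable_ofReal hi) k), integral_character_mul_eq_coeff,
      integral_character_mul_eq_coeff, coeff_series hs (coeff_neg f), sub_self]

/-! ### The Wiener norm of order zero -/

theorem freq_nonneg (k : Fin 2 → ℤ) : 0 ≤ freq k := Real.sqrt_nonneg _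

theorem wienerNorm_zero (f : Torus → ℝ) : wienerNorm 0 f = ∑' k, ‖coeff f k‖ₑ := by
  simp [wienerNorm]

theorem MemWiener.summable {f : Torus → ℝ} (h : MemWiener 0 f) : Summable fun k => ‖coeff f k‖ := by
  have h2 := h.2
  rw [wienerNorm_zero] at h2
  exact summable_norm_iff.2 (.of_enorm h2.ne)

theorem toReal_wienerNorm_zero (f : Torus → ℝ) :
    (wienerNorm 0 f).toReal = ∑' k, ‖coeff f k‖ := by
  rw [wienerNorm_zero, ENNReal.tsum_toReal_eq fun k => enorm_ne_top]
  simp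

/-! ### Existence of the Fourier coefficients of the solution -/

/-- The kernel of `2 K₁ det D²u` in Fourier variables. -/
def detKernel (K₁ : ℝ) (j l : Fin 2 → ℤ) : ℝ :=
  2 * K₁ * (j 0 * l 1 * (j 0 * l 1 - j 1 * l 0))

/-- The symbol of `-K₀ Δ + K₂ Δ²`. -/
def decayRate (K₀ K₂ : ℝ) (k : Fin 2 → ℤ) : ℝ := K₀ * freq k ^ 2 + K₂ * (freq k ^ 2) ^ 2

theorem freq_sq (k : Fin 2 → ℤ) : freq k ^ 2 = (k 0 : ℝ) ^ 2 + (k 1 : ℝ) ^ 2 := by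
  rw [freq, Real.sq_sqrt (Finset.sum_nonneg fun _ _ => sq_nonneg _), Fin.sum_univ_two]

theorem one_le_freq_sq {k : Fin 2 → ℤ} (hk : k ≠ 0) : 1 ≤ freq k ^ 2 := by
  have h : 0 < k 0 ^ 2 + k 1 ^ 2 := by
    by_contra! h
    have h0 : k 0 = 0 := by nlinarith [sq_nonneg (k 0), sq_nonneg (k 1)]
    have h1 : k 1 = 0 := by nlinarith [sq_nonneg (k 0), sq_nonneg (k 1)]
    exact hk (funext fun i => by fin_cases i <;> assumption)
  rw [freq_sq]
  exact_mod_cast h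

theorem freq_sq_le (k : Fin 2 → ℤ) : freq k ^ 2 ≤ (freq k ^ 2) ^ 2 := by
  rcases eq_or_ne k 0 with rfl | hk
  · simp [freq]
  · nlinarith [one_le_freq_sq hk]

/-- With `p = j₀l₁` and `q = j₀l₁ - j₁l₀` one has `2|pq| ≤ p² + q²`, `p² ≤ |j|²|l|²`, and `q² ≤
|j|²|l|²` from Lagrange's identity `q² + (j·l)² = |j|²|l|²`. The constant is what produces the
threshold `K₂ - 2K₁‖u₀‖`. -/
theorem abs_detKernel_le {K₁ : ℝ} (hK₁ : 0 ≤ K₁) (j l : Fin 2 → ℤ) :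
    |detKernel K₁ j l| ≤ 2 * K₁ * (freq j ^ 2 * freq l ^ 2) := by
  rw [detKernel, abs_mul, abs_of_nonneg (by positivity : 0 ≤ 2 * K₁)]
  refine mul_le_mul_of_nonneg_left ?_ (by positivity)
  rw [freq_sq, freq_sq, abs_le]
  constructor <;>
  nlinarith [sq_nonneg ((j 0 : ℝ) * l 1 - (j 0 * l 1 - j 1 * l 0)),
    sq_nonneg ((j 0 : ℝ) * l 1 + (j 0 * l 1 - j 1 * l 0)), sq_nonneg ((j 0 : ℝ) * l 0 + j 1 * l 1),
    sq_nonneg ((j 0 : ℝ) * l 0), sq_nonneg ((j 1 : ℝ) * l 0), sq_nonneg ((j 1 : ℝ) * l 1)]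

theorem isDissipative_coeff {K₀ K₁ K₂ : ℝ} (hK₀ : 0 ≤ K₀) (hK₁ : 0 ≤ K₁) {u₀ : Torus → ℝ}
    (hu₀ : MemWiener 0 u₀) (hmean : ∫ x, u₀ x = 0)
    (hsmall : 0 < K₂ - 2 * K₁ * (wienerNorm 0 u₀).toReal) :
    IsDissipative (decayRate K₀ K₂) (detKernel K₁) (fun k => freq k ^ 2) (coeff u₀) K₂ (2 * K₁)
      (wienerNorm 0 u₀).toReal where
  one_le _ hk := one_le_freq_sq hk
  weight_nonneg _ := sq_nonneg _
  le_dissipation k := by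
    rw [decayRate]
    nlinarith [mul_nonneg hK₀ (sq_nonneg (freq k))]
  abs_kernel_le := abs_detKernel_le hK₁
  kernel_neg j := by
    simp only [detKernel, Pi.neg_apply]
    push_cast
    ring
  data_zero := by
    have : ∫ x, ((u₀ x : ℝ) : ℂ) = 0 := by rw [integral_complex_ofReal, hmean, Complex.ofReal_zero]
    simp [coeff, character_zero, this]
  sum_data_le s := by
    rw [toReal_wienerNorm_zero]
    exact hu₀.summable.sum_le_tsum s fun _ _ => norm_nonneg _
  κ_nonneg := by positivity
  small := sub_pos.1 hsmall

/-- The Fourier coefficients of a solution with data `x`, whose `ℓ¹` norm is at most `a`. -/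
structure IsFourierSolution (K₀ K₁ K₂ : ℝ) (x : (Fin 2 → ℤ) → ℂ) (a : ℝ)
    (c : (Fin 2 → ℤ) → ℝ → ℂ) : Prop where
  conj_neg : ∀ t k, c (-k) t = conj (c k t)
  measurable : ∀ k, Measurable (c k)
  summable : ∀ t, Summable fun k => ‖c k t‖
  tsum_le : ∀ t, ∑' k, ‖c k t‖ ≤ a
  tsum_le_exp : ∀ t, 0 ≤ t → ∑' k, ‖c k t‖ ≤ Real.exp (-(K₂ - 2 * K₁ * a) * t) * a
  lintegral_lt_top : ∀ T,
    ∫⁻ t in Ioc 0 T, ∑' k, ENNReal.ofReal ((freq k ^ 2) ^ 2 * ‖c k t‖) < ∞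
  intervalIntegrable : ∀ k T, 0 ≤ T → IntervalIntegrable (fun t => -decayRate K₀ K₂ k • c k t +
    quadratic (detKernel K₁) (fun j => c j t) k) volume 0 T
  eq_integral : ∀ k T, 0 ≤ T → c k T = x k + ∫ t in (0 : ℝ)..T, (-decayRate K₀ K₂ k • c k t +
    quadratic (detKernel K₁) (fun j => c j t) k)

theorem exists_isFourierSolution {K₀ K₁ K₂ : ℝ} (hK₀ : 0 ≤ K₀) (hK₁ : 0 ≤ K₁)
    {u₀ : Torus → ℝ} (hu₀ : MemWiener 0 u₀) (hmean : ∫ x, u₀ x = 0)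
    (hsmall : 0 < K₂ - 2 * K₁ * (wienerNorm 0 u₀).toReal) :
    ∃ c, IsFourierSolution K₀ K₁ K₂ (coeff u₀) (wienerNorm 0 u₀).toReal c := by
  have h := isDissipative_coeff (K₀ := K₀) hK₀ hK₁ hu₀ hmean hsmall
  -- Boxes exhausting `ℤ²`, invariant under `k ↦ -k` so that truncation preserves reality.
  set S : ℕ → Finset (Fin 2 → ℤ) := fun n => Finset.Icc (fun _ => -(n : ℤ)) fun _ => (n : ℤ)
  have hS : Monotone S := fun m n hmn => Finset.Icc_subset_Icc
    (fun _ => neg_le_neg (Int.ofNat_le.2 hmn)) fun _ => Int.ofNat_le.2 hmn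
  have hS' : ∀ k, ∃ n, k ∈ S n := by
    intro k
    refine ⟨∑ i, (k i).natAbs, Finset.mem_Icc.2 ⟨fun i => ?_, fun i => ?_⟩⟩ <;>
    · have := Finset.single_le_sum (f := fun i => (k i).natAbs) (fun _ _ => Nat.zero_le _)
        (Finset.mem_univ i)
      simp only at this ⊢
      omega
  have hSneg : ∀ n k, k ∈ S n → -k ∈ S n := by
    intro n k hk
    rw [Finset.mem_Icc] at hk ⊢
    exact ⟨fun i => neg_le_neg (hk.2 i), fun i => neg_le.1 (hk.1 i)⟩
  set c := picardLim S (decayRate K₀ K₂) (detKernel K₁) (coeff u₀)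
  set g := majorantLim S (decayRate K₀ K₂) (detKernel K₁) (coeff u₀)
  have hcg : ∀ k t, ‖c k t‖ ≤ g k t := norm_picardLim_le h hS
  have hs : ∀ t, Summable fun k => ‖c k t‖ := fun t =>
    (summable_majorantLim h hS t).of_nonneg_of_le (fun _ => norm_nonneg _) fun k => hcg k t
  have hle : ∀ t, ∑' k, ‖c k t‖ ≤ ∑' k, g k t := fun t =>
    (hs t).tsum_le_tsum (fun k => hcg k t) (summable_majorantLim h hS t)
  refine ⟨c, fun t k => ?_, measurable_picardLim h hS, hs,
    fun t => (hle t).trans (tsum_majorantLim_le_data h hS t), fun t ht => ?_, fun T => ?_,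
    fun k T hT => (picardLim_eq_integral h hS hS' k hT).1,
    fun k T hT => (picardLim_eq_integral h hS hS' k hT).2⟩
  · refine picardLim_neg h hS hSneg (fun k => ?_) (fun j l => ?_) (coeff_neg u₀) k t
    · simp [decayRate, freq]
    · simp [detKernel]
  · have := (hle t).trans (tsum_majorantLim_le h hS t)
    rwa [max_eq_left ht, mul_comm] at this
  · refine lt_of_le_of_lt (lintegral_mono fun t => ENNReal.tsum_le_tsum fun k =>
      ENNReal.ofReal_le_ofReal ?_)
      ((lintegral_tsum_majorantLim_le h hS T).trans_lt ENNReal.ofReal_lt_top)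
    exact mul_le_mul_of_nonneg_left (hcg k t) (sq_nonneg _)

/-! ### Regularity of the solution -/

theorem timeMeasure_eq (T : ℝ) : timeMeasure T = volume.restrict (Ioc 0 T) :=
  Measure.restrict_congr_set Ioo_ae_eq_Ioc

theorem norm_symbol_le {α : Fin 2 → ℕ} (hα : α 0 + α 1 ≤ 2) (k : Fin 2 → ℤ) :
    ‖symbol α k‖ ≤ 1 + freq k ^ 2 := by
  have h : ∀ i, |(k i : ℝ)| ≤ freq k := fun i =>
    Real.abs_le_sqrt (Finset.single_le_sum (f := fun i => (k i : ℝ) ^ 2)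
      (fun _ _ => sq_nonneg _) (Finset.mem_univ i))
  have h1 : ‖symbol α k‖ ≤ freq k ^ (α 0 + α 1) := by
    have e : ∀ i, ‖(k i : ℂ)‖ = |(k i : ℝ)| := fun i => by
      rw [← Complex.ofReal_intCast, Complex.norm_real, Real.norm_eq_abs]
    rw [symbol, norm_mul, norm_pow, norm_pow, norm_mul, norm_mul, Complex.norm_I, one_mul, one_mul,
      pow_add, e, e]
    have := h 0
    have := h 1
    have := freq_nonneg k
    gcongr
  refine h1.trans ?_
  generalize α 0 + α 1 = n at hα
  interval_cases n <;> nlinarith [sq_nonneg (freq k), sq_nonneg (freq k - 1)]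

theorem measurable_series {Ω : Type*} [MeasurableSpace Ω] {a : (Fin 2 → ℤ) → Ω → ℂ}
    (ha : ∀ k, Measurable (a k)) :
    Measurable fun z : Ω × Torus => series (fun k => a k z.1) z.2 :=
  Measurable.tsum fun k => ((ha k).comp measurable_fst).mul
    ((continuous_character k).measurable.comp measurable_snd)

/-- The function with Fourier coefficients `c`. -/
def ofCoeff (c : (Fin 2 → ℤ) → ℝ → ℂ) (t : ℝ) (x : Torus) : ℝ := (series (fun k => c k t) x).re

/-- The derivative `D^α` of the function with Fourier coefficients `c`. -/
def ofCoeffDeriv (c : (Fin 2 → ℤ) → ℝ → ℂ) (α : Fin 2 → ℕ) (t : ℝ) (x : Torus) : ℝ :=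
  (series (fun k => symbol α k * c k t) x).re

namespace IsFourierSolution

variable {K₀ K₁ K₂ a : ℝ} {x : (Fin 2 → ℤ) → ℂ} {c : (Fin 2 → ℤ) → ℝ → ℂ}

/-- The `A⁴` norm of the solution at time `t`. -/
def fourthNorm (c : (Fin 2 → ℤ) → ℝ → ℂ) (t : ℝ) : ℝ := ∑' k, (freq k ^ 2) ^ 2 * ‖c k t‖

theorem fourthNorm_nonneg (c : (Fin 2 → ℤ) → ℝ → ℂ) (t : ℝ) : 0 ≤ fourthNorm c t :=
  tsum_nonneg fun _ => mul_nonneg (sq_nonneg _) (norm_nonneg _)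

theorem measurable_ofReal_fourth (h : IsFourierSolution K₀ K₁ K₂ x a c) :
    Measurable fun t => ∑' k, ENNReal.ofReal ((freq k ^ 2) ^ 2 * ‖c k t‖) :=
  Measurable.tsum fun k => ((h.measurable k).norm.const_mul _).ennreal_ofReal

theorem ae_summable (h : IsFourierSolution K₀ K₁ K₂ x a c) (T : ℝ) :
    ∀ᵐ t ∂timeMeasure T, Summable fun k => (freq k ^ 2) ^ 2 * ‖c k t‖ := by
  rw [timeMeasure_eq]
  filter_upwards [ae_lt_top h.measurable_ofReal_fourth (h.lintegral_lt_top T).ne] with t ht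
  refine (ENNReal.summable_toReal ht.ne).congr fun k => ?_
  rw [ENNReal.toReal_ofReal (mul_nonneg (sq_nonneg _) (norm_nonneg _))]

theorem integrable_fourthNorm (h : IsFourierSolution K₀ K₁ K₂ x a c) (T : ℝ) :
    Integrable (fourthNorm c) (timeMeasure T) := by
  rw [timeMeasure_eq]
  refine (integrable_toReal_of_lintegral_ne_top h.measurable_ofReal_fourth.aemeasurable
    (h.lintegral_lt_top T).ne).congr (.of_forall fun t => ?_)
  simp only [fourthNorm]
  rw [ENNReal.tsum_toReal_eq fun k => ENNReal.ofReal_ne_top]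
  exact tsum_congr fun k => ENNReal.toReal_ofReal (mul_nonneg (sq_nonneg _) (norm_nonneg _))

theorem bound_nonneg (h : IsFourierSolution K₀ K₁ K₂ x a c) : 0 ≤ a :=
  (tsum_nonneg fun _ => norm_nonneg _).trans (h.tsum_le 0)

/-- Two derivatives sit halfway between `A⁰` and `A⁴`. The square root in the interpolation turns
`L¹(A⁴)` into square integrability in time of the second derivatives. -/
theorem summable_symbol (h : IsFourierSolution K₀ K₁ K₂ x a c) {α : Fin 2 → ℕ}
    (hα : α 0 + α 1 ≤ 2) {t : ℝ} (ht : Summable fun k => (freq k ^ 2) ^ 2 * ‖c k t‖) :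
    (Summable fun k => ‖symbol α k * c k t‖) ∧
      ∑' k, ‖symbol α k * c k t‖ ≤ a + √(a * fourthNorm c t) := by
  obtain ⟨h1, h2⟩ := summable_weight_mul (w := fun k => freq k ^ 2) (fun k => sq_nonneg _)
    (fun k => norm_nonneg (c k t)) (h.summable t) ht
  have hle : ∀ k, ‖symbol α k * c k t‖ ≤ ‖c k t‖ + freq k ^ 2 * ‖c k t‖ := fun k => by
    rw [norm_mul, ← one_add_mul]
    exact mul_le_mul_of_nonneg_right (norm_symbol_le hα k) (norm_nonneg _)
  have hs := (h.summable t).add h1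
  have hs' := hs.of_nonneg_of_le (fun _ => norm_nonneg _) hle
  refine ⟨hs', (hs'.tsum_le_tsum hle hs).trans ?_⟩
  rw [(h.summable t).tsum_add h1]
  refine add_le_add (h.tsum_le t) (Real.le_sqrt_of_sq_le (h2.trans ?_))
  exact mul_le_mul_of_nonneg_right (h.tsum_le t) (fourthNorm_nonneg c t)

theorem measurable_ofCoeff (h : IsFourierSolution K₀ K₁ K₂ x a c) :
    Measurable (Function.uncurry (ofCoeff c)) :=
  Complex.measurable_re.comp (measurable_series h.measurable)

theorem measurable_ofCoeffDeriv (h : IsFourierSolution K₀ K₁ K₂ x a c) (α : Fin 2 → ℕ) :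
    Measurable (Function.uncurry (ofCoeffDeriv c α)) :=
  Complex.measurable_re.comp (measurable_series fun k => (h.measurable k).const_mul _)

theorem norm_ofCoeff_le (h : IsFourierSolution K₀ K₁ K₂ x a c) (t : ℝ) (y : Torus) :
    ‖ofCoeff c t y‖ ≤ a :=
  (Complex.abs_re_le_norm _).trans ((norm_series_le (h.summable t) y).trans (h.tsum_le t))

theorem integrable_ofCoeff (h : IsFourierSolution K₀ K₁ K₂ x a c) (t : ℝ) :
    Integrable (ofCoeff c t) :=
  (integrable_series (h.summable t)).re

theorem coeff_ofCoeff (h : IsFourierSolution K₀ K₁ K₂ x a c) (t : ℝ) (k : Fin 2 → ℤ) :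
    coeff (ofCoeff c t) k = c k t :=
  coeff_series (h.summable t) (h.conj_neg t) k

theorem memWiener_zero (h : IsFourierSolution K₀ K₁ K₂ x a c) (t : ℝ) :
    MemWiener 0 (ofCoeff c t) := by
  refine ⟨h.integrable_ofCoeff t, ?_⟩
  simp only [wienerNorm_zero, h.coeff_ofCoeff]
  simpa only [ofReal_norm] using (h.summable t).tsum_ofReal_lt_top

theorem toReal_wienerNorm (h : IsFourierSolution K₀ K₁ K₂ x a c) (t : ℝ) :
    (wienerNorm 0 (ofCoeff c t)).toReal = ∑' k, ‖c k t‖ := by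
  simp only [toReal_wienerNorm_zero, h.coeff_ofCoeff]

theorem wienerNorm_four (h : IsFourierSolution K₀ K₁ K₂ x a c) (t : ℝ) :
    wienerNorm 4 (ofCoeff c t) = ∑' k, ENNReal.ofReal ((freq k ^ 2) ^ 2 * ‖c k t‖) := by
  simp only [wienerNorm, h.coeff_ofCoeff]
  refine tsum_congr fun k => ?_
  rw [ENNReal.ofReal_mul (sq_nonneg _), ofReal_norm, ← pow_mul]
  norm_cast

theorem measurable_wienerNorm (h : IsFourierSolution K₀ K₁ K₂ x a c) (s : ℝ) :
    Measurable fun t => wienerNorm s (ofCoeff c t) := by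
  simp only [wienerNorm, h.coeff_ofCoeff]
  exact Measurable.tsum fun k => (h.measurable k).enorm.const_mul _

theorem memLpWiener_zero (h : IsFourierSolution K₀ K₁ K₂ x a c) (T : ℝ) :
    MemLpWiener T ∞ 0 (ofCoeff c) := by
  refine ⟨h.measurable_ofCoeff.aestronglyMeasurable, .of_forall h.memWiener_zero,
    (h.measurable_wienerNorm 0).aemeasurable, ?_⟩
  rw [eLpNorm_exponent_top]
  refine (eLpNormEssSup_le_of_ae_enorm_bound (C := ENNReal.ofReal a)
    (.of_forall fun t => ?_)).trans_lt ENNReal.ofReal_lt_top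
  rw [enorm_eq_self, ← ENNReal.ofReal_toReal (h.memWiener_zero t).2.ne, h.toReal_wienerNorm]
  exact ENNReal.ofReal_le_ofReal (h.tsum_le t)

theorem memLpWiener_four (h : IsFourierSolution K₀ K₁ K₂ x a c) (T : ℝ) :
    MemLpWiener T 1 4 (ofCoeff c) := by
  refine ⟨h.measurable_ofCoeff.aestronglyMeasurable, ?_,
    (h.measurable_wienerNorm 4).aemeasurable, ?_⟩
  · rw [timeMeasure_eq]
    filter_upwards [ae_lt_top h.measurable_ofReal_fourth (h.lintegral_lt_top T).ne] with t ht
    exact ⟨h.integrable_ofCoeff t, by rwa [h.wienerNorm_four]⟩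
  · rw [eLpNorm_one_eq_lintegral_enorm, timeMeasure_eq]
    simpa only [enorm_eq_self, h.wienerNorm_four] using h.lintegral_lt_top T

theorem memLp_top (h : IsFourierSolution K₀ K₁ K₂ x a c) (T : ℝ) :
    MemLp (Function.uncurry (ofCoeff c)) ∞ (slab T) :=
  memLp_top_of_bound h.measurable_ofCoeff.aestronglyMeasurable a
    (.of_forall fun z => h.norm_ofCoeff_le z.1 z.2)

theorem memLpSobolevWith (h : IsFourierSolution K₀ K₁ K₂ x a c) (T : ℝ) :
    MemLpSobolevWith T 2 2 4 (ofCoeff c) (ofCoeffDeriv c) := by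
  refine ⟨h.measurable_ofCoeff.aestronglyMeasurable, fun α hα =>
    ⟨(h.measurable_ofCoeffDeriv α).aestronglyMeasurable, ?_, ?_⟩⟩
  · filter_upwards [h.ae_summable T] with t ht
    exact isWeakDeriv_series (h.summable t) (h.conj_neg t) α (h.summable_symbol hα ht).1
  -- `M` converts the sup bound from the Fourier series into an `L⁴` bound. The square of `B` is
  -- dominated by an affine function of `fourthNorm`.
  · set M : ℝ≥0∞ := (volume : Measure Torus) univ ^ (4 : ℝ≥0∞).toReal⁻¹
    have hM : M ≠ ∞ := (ENNReal.rpow_lt_top_of_nonneg (by simp) (measure_ne_top _ _)).ne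
    set B : ℝ → ℝ := fun t => M.toReal * (a + √(a * fourthNorm c t))
    have hBm : AEStronglyMeasurable B (timeMeasure T) := by
      have := (h.integrable_fourthNorm T).aestronglyMeasurable
      exact ((Real.continuous_sqrt.comp_aestronglyMeasurable (this.const_mul a)).const_add
        a).const_mul _
    have hB : MemLp B 2 (timeMeasure T) := by
      refine (memLp_two_iff_integrable_sq hBm).2 ?_
      have hi : Integrable (fun t => M.toReal ^ 2 * (2 * (a ^ 2 + a * fourthNorm c t)))
          (timeMeasure T) :=
        (((integrable_const (a ^ 2)).add ((h.integrable_fourthNorm T).const_mul a)).const_mul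
          2).const_mul _
      refine hi.mono' (hBm.pow 2) (.of_forall fun t => ?_)
      have h0 : 0 ≤ a * fourthNorm c t := mul_nonneg h.bound_nonneg (fourthNorm_nonneg c t)
      rw [Real.norm_of_nonneg (sq_nonneg _), mul_pow]
      refine mul_le_mul_of_nonneg_left ?_ (sq_nonneg _)
      nlinarith [Real.sq_sqrt h0, sq_nonneg (a - √(a * fourthNorm c t))]
    refine (eLpNorm_mono_enorm_ae ?_).trans_lt hB.eLpNorm_lt_top
    filter_upwards [h.ae_summable T] with t ht
    obtain ⟨h1, h2⟩ := h.summable_symbol hα ht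
    have h3 : ∀ y, ‖ofCoeffDeriv c α t y‖ ≤ a + √(a * fourthNorm c t) := fun y =>
      (Complex.abs_re_le_norm _).trans ((norm_series_le h1 y).trans h2)
    have hpos : 0 ≤ a + √(a * fourthNorm c t) := add_nonneg h.bound_nonneg (Real.sqrt_nonneg _)
    rw [enorm_eq_self, Real.enorm_of_nonneg (mul_nonneg ENNReal.toReal_nonneg hpos),
      ENNReal.ofReal_mul ENNReal.toReal_nonneg, ENNReal.ofReal_toReal hM]
    exact eLpNorm_le_of_ae_bound (.of_forall h3)

end IsFourierSolution

/-! ### Integration by parts for absolutely continuous functions -/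

/-- By Fubini the two integrals cover the two triangles of the square. The diagonal is assigned to
only one of them, so the indicators add up to one at every point. -/
theorem integral_mul_primitive_add {a b : ℝ → ℂ} {T : ℝ}
    (ha : IntegrableOn a (Ioc 0 T)) (hb : IntegrableOn b (Ioc 0 T)) :
    (∫ t in Ioc 0 T, (∫ s in Ioc 0 t, a s) * b t) + ∫ t in Ioc 0 T, a t * ∫ s in Ioc 0 t, b s =
      (∫ t in Ioc 0 T, a t) * ∫ t in Ioc 0 T, b t := by
  set μ := (volume : Measure ℝ).restrict (Ioc 0 T)
  have hA : ∀ t ∈ Ioc 0 T, ∫ s in Ioc 0 t, a s = ∫ s, (Iic t).indicator a s ∂μ := by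
    intro t ht
    rw [integral_indicator measurableSet_Iic, Measure.restrict_restrict measurableSet_Iic,
      inter_comm, Ioc_inter_Iic, min_eq_right ht.2]
  have hB : ∀ t ∈ Ioc 0 T, ∫ s in Ioc 0 t, b s = ∫ s, (Iio t).indicator b s ∂μ := by
    intro t ht
    rw [integral_indicator measurableSet_Iio, Measure.restrict_restrict measurableSet_Iio,
      integral_Ioc_eq_integral_Ioo]
    congr 2
    ext s
    simp only [mem_Ioo, mem_inter_iff, mem_Iio, mem_Ioc]
    exact ⟨fun h => ⟨h.2, h.1, h.2.le.trans ht.2⟩, fun h => ⟨h.2.1, h.1⟩⟩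
  have h1 : ∫ t in Ioc 0 T, (∫ s in Ioc 0 t, a s) * b t =
      ∫ t, ∫ s, (Iic t).indicator a s * b t ∂μ ∂μ :=
    setIntegral_congr_fun measurableSet_Ioc fun t ht => by
      simp only [hA t ht, integral_mul_const]
  have h2 : ∫ t in Ioc 0 T, a t * ∫ s in Ioc 0 t, b s =
      ∫ t, ∫ s, a t * (Iio t).indicator b s ∂μ ∂μ :=
    setIntegral_congr_fun measurableSet_Ioc fun t ht => by
      simp only [hB t ht, integral_const_mul]
  have hf : Integrable (Function.uncurry fun t s => (Iic t).indicator a s * b t) (μ.prod μ) := by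
    refine ((ha.mul_prod hb).swap.indicator (s := {z : ℝ × ℝ | z.2 ≤ z.1})
      (measurableSet_le measurable_snd measurable_fst)).congr (.of_forall fun z => ?_)
    simp only [indicator, mem_ofPred_eq, Function.uncurry, mem_Iic]
    split_ifs <;> simp
  have hg : Integrable (Function.uncurry fun t s => a t * (Iio t).indicator b s) (μ.prod μ) := by
    refine ((ha.mul_prod hb).indicator (s := {z : ℝ × ℝ | z.2 < z.1})
      (measurableSet_lt measurable_snd measurable_fst)).congr (.of_forall fun z => ?_)
    simp only [indicator, mem_ofPred_eq, Function.uncurry, mem_Iio]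
    split_ifs <;> simp
  have hf' : Integrable (fun t => ∫ s, (Iic t).indicator a s * b t ∂μ) μ := hf.integral_prod_left
  have hg' : Integrable (fun t => ∫ s, a s * (Iio s).indicator b t ∂μ) μ :=
    hg.swap.integral_prod_left
  rw [h1, h2, integral_integral_swap hg, ← integral_add hf' hg']
  calc ∫ t, ((∫ s, (Iic t).indicator a s * b t ∂μ) + ∫ s, a s * (Iio s).indicator b t ∂μ) ∂μ
      = ∫ t, ∫ s, a s * b t ∂μ ∂μ := by
        refine integral_congr_ae ?_
        filter_upwards [hf.prod_right_ae, hg.swap.prod_right_ae] with t h3 h4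
        simp only [Function.uncurry, Function.comp_apply, Prod.swap] at h3 h4
        rw [← integral_add h3 h4]
        refine integral_congr_ae (.of_forall fun s => ?_)
        simp only [indicator, mem_Iic, mem_Iio]
        rcases le_or_gt s t with h | h
        · simp [h, not_lt.2 h]
        · simp [h, not_le.2 h]
    _ = _ := by simp only [integral_mul_const, integral_const_mul]

theorem integral_by_parts {A B a b : ℝ → ℂ} {T : ℝ} (hT : 0 ≤ T)
    (ha : IntegrableOn a (Ioc 0 T)) (hb : IntegrableOn b (Ioc 0 T))
    (hA : ∀ t ∈ Icc 0 T, A t = A 0 + ∫ s in (0 : ℝ)..t, a s)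
    (hB : ∀ t ∈ Icc 0 T, B t = B 0 + ∫ s in (0 : ℝ)..t, b s) :
    ∫ t in Ioc 0 T, (A t * b t + a t * B t) = A T * B T - A 0 * B 0 := by
  have hca : ContinuousOn (fun t => ∫ s in Ioc 0 t, a s) (Icc 0 T) :=
    intervalIntegral.continuousOn_primitive ((integrableOn_Icc_iff_integrableOn_Ioc).2 ha)
  have hcb : ContinuousOn (fun t => ∫ s in Ioc 0 t, b s) (Icc 0 T) :=
    intervalIntegral.continuousOn_primitive ((integrableOn_Icc_iff_integrableOn_Ioc).2 hb)
  have hi1 : IntegrableOn (fun t => (∫ s in Ioc 0 t, a s) * b t) (Ioc 0 T) :=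
    (((integrableOn_Icc_iff_integrableOn_Ioc).2 hb).continuousOn_mul hca
      isCompact_Icc).mono_set Ioc_subset_Icc_self
  have hi2 : IntegrableOn (fun t => a t * ∫ s in Ioc 0 t, b s) (Ioc 0 T) :=
    (((integrableOn_Icc_iff_integrableOn_Ioc).2 ha).mul_continuousOn hcb
      isCompact_Icc).mono_set Ioc_subset_Icc_self
  have e : ∫ t in Ioc 0 T, (A t * b t + a t * B t) =
      ∫ t in Ioc 0 T, ((A 0 * b t + a t * B 0) +
        ((∫ s in Ioc 0 t, a s) * b t + a t * ∫ s in Ioc 0 t, b s)) := by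
    refine setIntegral_congr_fun measurableSet_Ioc fun t ht => ?_
    simp only [hA t ⟨ht.1.le, ht.2⟩, hB t ⟨ht.1.le, ht.2⟩, intervalIntegral.integral_of_le ht.1.le]
    ring
  have hi3 : IntegrableOn (fun t => A 0 * b t) (Ioc 0 T) := hb.const_mul _
  have hi4 : IntegrableOn (fun t => a t * B 0) (Ioc 0 T) := ha.mul_const _
  rw [e, integral_add (f := fun t => A 0 * b t + a t * B 0)
      (g := fun t => (∫ s in Ioc 0 t, a s) * b t + a t * ∫ s in Ioc 0 t, b s)
      (hi3.add hi4) (hi1.add hi2), integral_add hi3 hi4, integral_add hi1 hi2,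
    integral_mul_primitive_add ha hb, integral_const_mul, integral_mul_const,
    hA T ⟨hT, le_rfl⟩, hB T ⟨hT, le_rfl⟩, intervalIntegral.integral_of_le hT,
    intervalIntegral.integral_of_le hT]
  ring

/-! ### Fourier coefficients of test functions -/

theorem slab_eq (T : ℝ) :
    slab T = (volume.restrict (Ioc 0 T)).prod (volume : Measure Torus) := by
  rw [slab, timeMeasure_eq]

theorem slab_mono {s T : ℝ} (h : s ≤ T) : slab s ≤ slab T := by
  rw [slab_eq, slab_eq]
  exact Measure.prod_mono (Measure.restrict_mono (Ioc_subset_Ioc_right h) le_rfl) le_rfl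

theorem integrable_character_mul_slab {ψ : ℝ → Torus → ℝ} {T : ℝ}
    (hψ : Integrable (Function.uncurry ψ) (slab T)) (k : Fin 2 → ℤ) :
    Integrable (fun z : ℝ × Torus => character k z.2 * (ψ z.1 z.2 : ℂ)) (slab T) := by
  have h : Integrable (fun z : ℝ × Torus => (ψ z.1 z.2 : ℂ)) (slab T) := hψ.ofReal
  exact h.bdd_mul (c := 1)
    ((continuous_character k).comp continuous_snd).measurable.aestronglyMeasurable
    (.of_forall fun z => (norm_character k z.2).le)

/-- `(2π)²` times the Fourier coefficient of `ψ(t)` at `-k`. -/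
def testCoeff (ψ : ℝ → Torus → ℝ) (k : Fin 2 → ℤ) (t : ℝ) : ℂ :=
  ∫ x, character k x * (ψ t x : ℂ)

theorem norm_testCoeff_le (ψ : ℝ → Torus → ℝ) (k : Fin 2 → ℤ) (t : ℝ) :
    ‖testCoeff ψ k t‖ ≤ ∫ x, ‖ψ t x‖ := by
  refine (norm_integral_le_integral_norm _).trans (le_of_eq ?_)
  simp [norm_character]

section TestFunction

variable {T : ℝ} {φ φt : ℝ → Torus → ℝ} {D : (Fin 2 → ℕ) → ℝ → Torus → ℝ}

theorem MemW11With.integrable_integral (h : MemW11With T φ φt) {t : ℝ} (ht : t ∈ Icc 0 T) :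
    (Integrable fun x => ∫ s in (0 : ℝ)..t, φt s x) ∧
      ∫ x, ‖∫ s in (0 : ℝ)..t, φt s x‖ ≤ ∫ z, ‖φt z.1 z.2‖ ∂slab T := by
  have h1 : Integrable (Function.uncurry φt) (slab t) := h.2.1.mono_measure (slab_mono ht.2)
  have h1' := h1
  rw [slab_eq] at h1
  simp only [intervalIntegral.integral_of_le ht.1]
  refine ⟨h1.integral_prod_right, ?_⟩
  calc ∫ x, ‖∫ s in Ioc 0 t, φt s x‖ ≤ ∫ x, ∫ s in Ioc 0 t, ‖φt s x‖ :=
        integral_mono h1.integral_prod_right.norm h1.norm.integral_prod_right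
          fun x => norm_integral_le_integral_norm _
    _ = ∫ z, ‖φt z.1 z.2‖ ∂slab t := by
        rw [slab_eq]
        exact (integral_prod_symm _ h1.norm).symm
    _ ≤ ∫ z, ‖φt z.1 z.2‖ ∂slab T :=
        integral_mono_measure (slab_mono ht.2) (.of_forall fun z => norm_nonneg _) h.2.1.norm

theorem MemW11With.integrable_slice (h : MemW11With T φ φt) {t : ℝ} (ht : t ∈ Icc 0 T) :
    Integrable (φ t) :=
  (h.2.2.1.add (h.integrable_integral ht).1).congr (h.2.2.2 t ht).symm

/-- This uniform bound in time on the `L¹` norm of `φ(t)` pairs with `det D²u`, which is bounded in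
space but only integrable in time. -/
theorem MemW11With.integral_norm_le (h : MemW11With T φ φt) {t : ℝ} (ht : t ∈ Icc 0 T) :
    ∫ x, ‖φ t x‖ ≤ (∫ x, ‖φ 0 x‖) + ∫ z, ‖φt z.1 z.2‖ ∂slab T := by
  obtain ⟨h1, h2⟩ := h.integrable_integral ht
  calc ∫ x, ‖φ t x‖ ≤ ∫ x, (‖φ 0 x‖ + ‖∫ s in (0 : ℝ)..t, φt s x‖) := by
        refine integral_mono_ae (h.integrable_slice ht).norm (h.2.2.1.norm.add h1.norm) ?_
        filter_upwards [h.2.2.2 t ht] with x hx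
        rw [hx]
        exact norm_add_le _ _
    _ ≤ _ := by
        rw [integral_add h.2.2.1.norm h1.norm]
        exact add_le_add_right h2 _

theorem MemW11With.testCoeff_eq (h : MemW11With T φ φt) (k : Fin 2 → ℤ) {t : ℝ}
    (ht : t ∈ Icc 0 T) :
    testCoeff φ k t = testCoeff φ k 0 + ∫ s in (0 : ℝ)..t, testCoeff φt k s := by
  obtain ⟨h1, -⟩ := h.integrable_integral ht
  have h2 := integrable_character_mul_slab (h.2.1.mono_measure (slab_mono ht.2)) k
  rw [slab_eq] at h2
  have e : testCoeff φ k t = ∫ x, (character k x * (φ 0 x : ℂ) +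
      character k x * ((∫ s in (0 : ℝ)..t, φt s x : ℝ) : ℂ)) := by
    refine integral_congr_ae ?_
    filter_upwards [h.2.2.2 t ht] with x hx
    rw [hx]
    push_cast
    ring
  rw [e, integral_add (integrable_mul_character (integrable_ofReal h.2.2.1) k)
    (integrable_mul_character (integrable_ofReal h1) k)]
  congr 1
  rw [intervalIntegral.integral_of_le ht.1]
  simp only [testCoeff]
  rw [integral_integral_swap h2]
  refine integral_congr_ae (.of_forall fun x => ?_)
  simp only
  rw [intervalIntegral.integral_of_le ht.1, ← integral_complex_ofReal, ← integral_const_mul]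

theorem integrable_testCoeff {ψ : ℝ → Torus → ℝ} (hψ : Integrable (Function.uncurry ψ) (slab T))
    (k : Fin 2 → ℤ) : Integrable (testCoeff ψ k) (timeMeasure T) :=
  (integrable_character_mul_slab hψ k).integral_prod_left

theorem MemLpSobolevWith.integrable {m : ℕ} (h : MemLpSobolevWith T 1 m 1 φ D) {α : Fin 2 → ℕ}
    (hα : α 0 + α 1 ≤ m) : Integrable (Function.uncurry (D α)) (slab T) := by
  obtain ⟨h1, -, h3⟩ := h.2 α hα
  refine ⟨h1, ?_⟩
  rw [hasFiniteIntegral_iff_enorm, lintegral_prod _ h1.enorm]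
  simpa only [eLpNorm_one_eq_lintegral_enorm, enorm_eq_self, Function.uncurry] using h3

end TestFunction

/-! ### The weak formulation -/

theorem symbol_two_zero (k : Fin 2 → ℤ) : symbol ![2, 0] k = -((k 0 : ℂ) ^ 2) := by
  simp [symbol, mul_pow]

theorem symbol_zero_two (k : Fin 2 → ℤ) : symbol ![0, 2] k = -((k 1 : ℂ) ^ 2) := by
  simp [symbol, mul_pow]

theorem symbol_one_one (k : Fin 2 → ℤ) : symbol ![1, 1] k = -((k 0 : ℂ) * k 1) := by
  simp only [symbol, Matrix.cons_val_zero, Matrix.cons_val_one, pow_one]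
  linear_combination (k 0 : ℂ) * k 1 * Complex.I_mul_I

theorem symbol_laplacian (k : Fin 2 → ℤ) :
    symbol ![2, 0] k + symbol ![0, 2] k = -((freq k ^ 2 : ℝ) : ℂ) := by
  rw [symbol_two_zero, symbol_zero_two, freq_sq]
  push_cast
  ring

theorem symbol_bilaplacian (k : Fin 2 → ℤ) :
    symbol ![4, 0] k + 2 * symbol ![2, 2] k + symbol ![0, 4] k = (((freq k ^ 2) ^ 2 : ℝ) : ℂ) := by
  simp only [symbol, Matrix.cons_val_zero, Matrix.cons_val_one, pow_zero, freq_sq, mul_pow,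
    Complex.I_pow_four, Complex.I_sq]
  push_cast
  ring

section Test

variable {T K₀ K₁ K₂ : ℝ} {φ φt : ℝ → Torus → ℝ} {D : (Fin 2 → ℕ) → ℝ → Torus → ℝ}

/-- `K₀ Δφ - K₂ Δ²φ`. -/
def linearPart (K₀ K₂ : ℝ) (D : (Fin 2 → ℕ) → ℝ → Torus → ℝ) (t : ℝ) (y : Torus) : ℝ :=
  K₀ * laplacian D t y - K₂ * bilaplacian D t y

theorem IsTestFunction.integrable_linearPart (h : IsTestFunction T φ φt D) :
    Integrable (Function.uncurry (linearPart K₀ K₂ D)) (slab T) := by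
  have h1 : ∀ i j : ℕ, i + j ≤ 4 → Integrable (fun z : ℝ × Torus => D ![i, j] z.1 z.2) (slab T) :=
    fun i j hij => h.memL1W41.integrable (α := ![i, j]) hij
  exact (((h1 2 0 (by norm_num)).add (h1 0 2 (by norm_num))).const_mul K₀).sub
    ((((h1 4 0 (by norm_num)).add ((h1 2 2 (by norm_num)).const_mul 2)).add
      (h1 0 4 (by norm_num))).const_mul K₂)

/-- The derivatives involved have even order, so the signs cancel and the symbols combine to those
of `Δ` and `Δ²`. Only five weak derivatives enter, so one null set of times serves every `k`. -/
theorem IsTestFunction.ae_testCoeff_linearPart (h : IsTestFunction T φ φt D) :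
    ∀ᵐ t ∂timeMeasure T, ∀ k, testCoeff (linearPart K₀ K₂ D) k t =
      -(decayRate K₀ K₂ k : ℂ) * testCoeff φ k t := by
  have hw : ∀ i j : ℕ, i + j ≤ 4 → ∀ᵐ t ∂timeMeasure T, IsWeakDeriv ![i, j] (φ t) (D ![i, j] t) :=
    fun i j hij => (h.memL1W41.2 ![i, j] hij).2.1
  filter_upwards [hw 2 0 (by norm_num), hw 0 2 (by norm_num), hw 4 0 (by norm_num),
    hw 2 2 (by norm_num), hw 0 4 (by norm_num)] with t h20 h02 h40 h22 h04 k
  have hi : ∀ {g : Torus → ℝ}, Integrable g → Integrable fun x => character k x * (g x : ℂ) :=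
    fun hg => integrable_mul_character (integrable_ofReal hg) k
  have e : testCoeff (linearPart K₀ K₂ D) k t =
      K₀ * ((∫ x, character k x * (D ![2, 0] t x : ℂ)) + ∫ x, character k x * (D ![0, 2] t x : ℂ)) -
      K₂ * ((∫ x, character k x * (D ![4, 0] t x : ℂ)) +
        2 * (∫ x, character k x * (D ![2, 2] t x : ℂ)) +
          ∫ x, character k x * (D ![0, 4] t x : ℂ)) := by
    have i1 : Integrable fun x => character k x * (D ![2, 0] t x : ℂ) +
        character k x * (D ![0, 2] t x : ℂ) := (hi h20.2.1).add (hi h02.2.1)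
    have i2 : Integrable fun x => character k x * (D ![4, 0] t x : ℂ) +
        2 * (character k x * (D ![2, 2] t x : ℂ)) := (hi h40.2.1).add ((hi h22.2.1).const_mul 2)
    have i3 : Integrable fun x => character k x * (D ![4, 0] t x : ℂ) +
        2 * (character k x * (D ![2, 2] t x : ℂ)) + character k x * (D ![0, 4] t x : ℂ) :=
      i2.add (hi h04.2.1)
    rw [← integral_const_mul 2, ← integral_add (hi h20.2.1) (hi h02.2.1),
      ← integral_add (hi h40.2.1) ((hi h22.2.1).const_mul 2), ← integral_add i2 (hi h04.2.1),
      ← integral_const_mul, ← integral_const_mul,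
      ← integral_sub (i1.const_mul _) (i3.const_mul _)]
    refine integral_congr_ae (.of_forall fun x => ?_)
    simp only [linearPart, laplacian, bilaplacian]
    push_cast
    ring
  rw [e, h20.integral_character_mul, h02.integral_character_mul, h40.integral_character_mul,
    h22.integral_character_mul, h04.integral_character_mul, decayRate]
  have e1 := symbol_laplacian k
  have e2 := symbol_bilaplacian k
  simp only [Matrix.cons_val_zero, Matrix.cons_val_one, testCoeff]
  push_cast at e1 e2 ⊢
  norm_num
  linear_combination (K₀ : ℂ) * (∫ x, character k x * (φ t x : ℂ)) * e1 -
    (K₂ : ℂ) * (∫ x, character k x * (φ t x : ℂ)) * e2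

end Test

namespace IsFourierSolution

variable {K₀ K₁ K₂ a T : ℝ} {x : (Fin 2 → ℤ) → ℂ} {c : (Fin 2 → ℤ) → ℝ → ℂ}
  {φ φt : ℝ → Torus → ℝ} {D : (Fin 2 → ℕ) → ℝ → Torus → ℝ}

theorem summable_quadratic (h : IsFourierSolution K₀ K₁ K₂ x a c) (hK₁ : 0 ≤ K₁) {t : ℝ}
    (ht : Summable fun k => (freq k ^ 2) ^ 2 * ‖c k t‖) :
    (Summable fun k => ‖quadratic (detKernel K₁) (fun j => c j t) k‖) ∧
      ∑' k, ‖quadratic (detKernel K₁) (fun j => c j t) k‖ ≤ 2 * K₁ * (a * fourthNorm c t) := by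
  obtain ⟨h1, h2⟩ := summable_norm_quadratic (fun k => le_refl ‖c k t‖)
    (w := fun k => freq k ^ 2) (fun k => sq_nonneg _) (abs_detKernel_le hK₁) (by positivity)
    (h.summable t) ht
  refine ⟨h1, h2.trans (mul_le_mul_of_nonneg_left ?_ (by positivity))⟩
  exact mul_le_mul_of_nonneg_right (h.tsum_le t) (fourthNorm_nonneg c t)

/-- Products of absolutely convergent series are convolutions, and the symbols combine through
`j₀²l₁² - j₀j₁l₀l₁ = j₀l₁(j₀l₁ - j₁l₀)`, which is where `detKernel` comes from. -/
theorem hessianDet_eq_series (h : IsFourierSolution K₀ K₁ K₂ x a c) (hK₁ : 0 ≤ K₁) {t : ℝ}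
    (ht : Summable fun k => (freq k ^ 2) ^ 2 * ‖c k t‖) (y : Torus) :
    ((2 * K₁ * hessianDet (ofCoeffDeriv c) t y : ℝ) : ℂ) =
      series (quadratic (detKernel K₁) fun j => c j t) y := by
  have hs : ∀ i j : ℕ, i + j ≤ 2 → Summable fun k => ‖symbol ![i, j] k * c k t‖ :=
    fun i j hij => (h.summable_symbol (α := ![i, j]) hij ht).1
  have hre : ∀ α, ((ofCoeffDeriv c α t y : ℝ) : ℂ) = series (fun k => symbol α k * c k t) y :=
    fun α => ofReal_re_series (a := fun k => symbol α k * c k t)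
      (fun k => by rw [symbol_neg, h.conj_neg, map_mul]) y
  have s20 := hs 2 0 (by norm_num)
  have s02 := hs 0 2 (by norm_num)
  have s11 := hs 1 1 (by norm_num)
  have h1 := (series_mul_series s20 s02 y).sub (series_mul_series s11 s11 y)
  have h2 := h1.mul_left (2 * (K₁ : ℂ))
  have h3 := hasSum_series (h.summable_quadratic hK₁ ht).1 y
  rw [hessianDet]
  push_cast
  rw [hre, hre, hre, sq]
  refine h2.unique (h3.congr_fun fun k => ?_)
  have p1 := (summable_convolution s20 s02).prod_factor k
  have p2 := (summable_convolution s11 s11).prod_factor k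
  rw [← sub_mul, ← p1.tsum_sub p2, ← mul_assoc, ← tsum_mul_left, quadratic]
  congr 1
  refine tsum_congr fun j => ?_
  rw [symbol_two_zero, symbol_zero_two, symbol_one_one, symbol_one_one, detKernel,
    Complex.real_smul]
  push_cast
  ring

/-- The determinant is bounded in space by a multiple of `fourthNorm`, integrable in time, while
`φ(t)` is bounded in `L¹` uniformly in time. -/
theorem integrable_det_mul (h : IsFourierSolution K₀ K₁ K₂ x a c) (hK₁ : 0 ≤ K₁)
    (hφ : MemW11With T φ φt) :
    Integrable (fun z : ℝ × Torus => 2 * K₁ * φ z.1 z.2 * hessianDet (ofCoeffDeriv c) z.1 z.2)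
      (slab T) := by
  set P := (∫ x, ‖φ 0 x‖) + ∫ z, ‖φt z.1 z.2‖ ∂slab T
  have hdet : Measurable fun z : ℝ × Torus => hessianDet (ofCoeffDeriv c) z.1 z.2 :=
    ((h.measurable_ofCoeffDeriv _).mul (h.measurable_ofCoeffDeriv _)).sub
      ((h.measurable_ofCoeffDeriv _).pow_const 2)
  have hm : AEStronglyMeasurable
      (fun z : ℝ × Torus => 2 * K₁ * φ z.1 z.2 * hessianDet (ofCoeffDeriv c) z.1 z.2) (slab T) :=
    (hφ.1.aestronglyMeasurable.const_mul (2 * K₁)).mul hdet.aestronglyMeasurable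
  have hb : ∀ᵐ t ∂timeMeasure T, ∀ y, ‖2 * K₁ * φ t y * hessianDet (ofCoeffDeriv c) t y‖ ≤
      2 * K₁ * (a * fourthNorm c t) * ‖φ t y‖ := by
    filter_upwards [h.ae_summable T] with t ht y
    have h1 : ‖2 * K₁ * hessianDet (ofCoeffDeriv c) t y‖ ≤ 2 * K₁ * (a * fourthNorm c t) := by
      rw [← Complex.norm_real, h.hessianDet_eq_series hK₁ ht]
      exact (norm_series_le (h.summable_quadratic hK₁ ht).1 y).trans
        (h.summable_quadratic hK₁ ht).2
    rw [mul_right_comm, norm_mul]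
    exact mul_le_mul_of_nonneg_right h1 (norm_nonneg _)
  have hφt : ∀ᵐ t ∂timeMeasure T, Integrable (φ t) ∧ ∫ x, ‖φ t x‖ ≤ P := by
    filter_upwards [ae_restrict_mem measurableSet_Ioo] with t ht
    have ht' : t ∈ Icc 0 T := ⟨ht.1.le, ht.2.le⟩
    exact ⟨hφ.integrable_slice ht', hφ.integral_norm_le ht'⟩
  refine (integrable_prod_iff hm).2 ⟨?_, ?_⟩
  · filter_upwards [hb, hφt, hm.prodMk_left] with t h1 h2 h3
    exact (h2.1.norm.const_mul _).mono' h3 (.of_forall h1)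
  · refine (((h.integrable_fourthNorm T).const_mul a).const_mul (2 * K₁) |>.mul_const P).mono'
      hm.norm.integral_prod_right' ?_
    filter_upwards [hb, hφt, hm.prodMk_left] with t h1 h2 h3
    rw [Real.norm_of_nonneg (integral_nonneg fun _ => norm_nonneg _)]
    calc ∫ y, ‖2 * K₁ * φ t y * hessianDet (ofCoeffDeriv c) t y‖
        ≤ ∫ y, 2 * K₁ * (a * fourthNorm c t) * ‖φ t y‖ :=
          integral_mono ((h2.1.norm.const_mul _).mono' h3 (.of_forall h1)).norm
            (h2.1.norm.const_mul _) h1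
      _ ≤ 2 * K₁ * (a * fourthNorm c t) * P := by
          rw [integral_const_mul]
          refine mul_le_mul_of_nonneg_left h2.2 ?_
          have := mul_nonneg h.bound_nonneg (fourthNorm_nonneg c t)
          positivity

theorem weakIntegrand_eq (z : ℝ × Torus) :
    weakIntegrand K₀ K₁ K₂ (ofCoeff c) (ofCoeffDeriv c) φ φt D z =
      ofCoeff c z.1 z.2 * φt z.1 z.2 + ofCoeff c z.1 z.2 * linearPart K₀ K₂ D z.1 z.2 +
        2 * K₁ * φ z.1 z.2 * hessianDet (ofCoeffDeriv c) z.1 z.2 := by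
  simp only [weakIntegrand, linearPart]
  ring

theorem integrable_ofCoeff_mul (h : IsFourierSolution K₀ K₁ K₂ x a c) {ψ : ℝ → Torus → ℝ}
    (hψ : Integrable (Function.uncurry ψ) (slab T)) :
    Integrable (fun z : ℝ × Torus => ofCoeff c z.1 z.2 * ψ z.1 z.2) (slab T) :=
  hψ.bdd_mul (c := a) h.measurable_ofCoeff.aestronglyMeasurable
    (.of_forall fun z => h.norm_ofCoeff_le z.1 z.2)

theorem integrable_weakIntegrand (h : IsFourierSolution K₀ K₁ K₂ x a c) (hK₁ : 0 ≤ K₁)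
    (hφ : IsTestFunction T φ φt D) :
    Integrable (weakIntegrand K₀ K₁ K₂ (ofCoeff c) (ofCoeffDeriv c) φ φt D) (slab T) := by
  simp only [funext fun z => weakIntegrand_eq (K₀ := K₀) (K₁ := K₁) (K₂ := K₂) (c := c) (φ := φ)
    (φt := φt) (D := D) z]
  exact ((h.integrable_ofCoeff_mul hφ.memW11.2.1).add
    (h.integrable_ofCoeff_mul hφ.integrable_linearPart)).add (h.integrable_det_mul hK₁ hφ.memW11)

variable (K₀ K₁ K₂ c φ φt) in
/-- The contribution of the mode `k` to the weak formulation. -/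
def modeIntegrand (k : Fin 2 → ℤ) (t : ℝ) : ℂ :=
  c k t * testCoeff φt k t + (-decayRate K₀ K₂ k • c k t +
    quadratic (detKernel K₁) (fun j => c j t) k) * testCoeff φ k t

theorem hasSum_ofCoeff_mul (h : IsFourierSolution K₀ K₁ K₂ x a c) {ψ : ℝ → Torus → ℝ} {t : ℝ}
    (hψ : Integrable (ψ t)) :
    HasSum (fun k => c k t * testCoeff ψ k t) ((∫ y, ofCoeff c t y * ψ t y : ℝ) : ℂ) := by
  have h1 := hasSum_integral_series_mul (h.summable t) (integrable_ofReal hψ)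
  rw [← integral_complex_ofReal]
  push_cast
  simp only [ofCoeff, ofReal_re_series (a := fun k => c k t) (h.conj_neg t)]
  exact h1

/-- Each of the three terms of the weak integrand is a Parseval pairing at almost every time; the
one with `K₀Δφ - K₂Δ²φ` supplies the linear decay term of the mode equation. -/
theorem ae_hasSum_modeIntegrand (h : IsFourierSolution K₀ K₁ K₂ x a c) (hK₁ : 0 ≤ K₁)
    (hφ : IsTestFunction T φ φt D) :
    ∀ᵐ t ∂timeMeasure T, HasSum (fun k => modeIntegrand K₀ K₁ K₂ c φ φt k t)
      ((∫ y, weakIntegrand K₀ K₁ K₂ (ofCoeff c) (ofCoeffDeriv c) φ φt D (t, y) : ℝ) : ℂ) := by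
  filter_upwards [h.ae_summable T, hφ.ae_testCoeff_linearPart (K₀ := K₀) (K₂ := K₂),
    hφ.memW11.2.1.prod_right_ae, hφ.integrable_linearPart (K₀ := K₀) (K₂ := K₂) |>.prod_right_ae,
    (h.integrable_ofCoeff_mul hφ.memW11.2.1).prod_right_ae,
    (h.integrable_ofCoeff_mul (hφ.integrable_linearPart (K₀ := K₀) (K₂ := K₂))).prod_right_ae,
    (h.integrable_det_mul hK₁ hφ.memW11).prod_right_ae, ae_restrict_mem measurableSet_Ioo]
    with t ht hL h1 h2 h3 h4 h5 htT
  have hφt : Integrable (φ t) := hφ.memW11.integrable_slice ⟨htT.1.le, htT.2.le⟩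
  have s1 := h.hasSum_ofCoeff_mul (ψ := φt) h1
  have s2 := h.hasSum_ofCoeff_mul (ψ := linearPart K₀ K₂ D) h2
  have s3 := hasSum_integral_series_mul (h.summable_quadratic hK₁ ht).1 (integrable_ofReal hφt)
  have e3 : ((∫ y, 2 * K₁ * φ t y * hessianDet (ofCoeffDeriv c) t y : ℝ) : ℂ) =
      ∫ y, series (quadratic (detKernel K₁) fun j => c j t) y * (φ t y : ℂ) := by
    rw [← integral_complex_ofReal]
    refine integral_congr_ae (.of_forall fun y => ?_)
    simp only [← h.hessianDet_eq_series hK₁ ht]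
    push_cast
    ring
  rw [← e3] at s3
  have s := (s1.add s2).add s3
  simp only [weakIntegrand_eq]
  rw [integral_add (f := fun y => ofCoeff c t y * φt t y + ofCoeff c t y * linearPart K₀ K₂ D t y)
    (h3.add h4) h5, integral_add h3 h4]
  push_cast
  refine s.congr_fun fun k => ?_
  rw [hL k, modeIntegrand, testCoeff, testCoeff, Complex.real_smul]
  push_cast
  ring

/-- By the mode equation the integrand is the derivative of a product of two absolutely continuous
functions; `φ(T) = 0` removes the upper boundary term. -/
theorem integral_modeIntegrand (h : IsFourierSolution K₀ K₁ K₂ x a c) (hT : 0 ≤ T)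
    (hφ : IsTestFunction T φ φt D) (k : Fin 2 → ℤ) :
    ∫ t, modeIntegrand K₀ K₁ K₂ c φ φt k t ∂timeMeasure T = -(x k * testCoeff φ k 0) := by
  have hc0 : c k 0 = x k := by simpa using h.eq_integral k 0 le_rfl
  have hφT : testCoeff φ k T = 0 := by
    rw [testCoeff, ← integral_zero Torus ℂ]
    refine integral_congr_ae ?_
    filter_upwards [hφ.final] with y hy
    simp [hy]
  have hi := integrable_testCoeff hφ.memW11.2.1 k
  rw [timeMeasure_eq] at hi ⊢
  have := integral_by_parts (A := c k) (B := testCoeff φ k) hT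
    ((intervalIntegrable_iff_integrableOn_Ioc_of_le hT).1 (h.intervalIntegrable k T hT)) hi
    (fun t ht => by rw [hc0]; exact h.eq_integral k t ht.1)
    (fun t ht => hφ.memW11.testCoeff_eq k ht)
  simp only [modeIntegrand]
  rw [this, hφT, hc0]
  ring

theorem abs_decayRate_le (hK₀ : 0 ≤ K₀) (hK₂ : 0 ≤ K₂) (k : Fin 2 → ℤ) :
    |decayRate K₀ K₂ k| ≤ (K₀ + K₂) * (freq k ^ 2) ^ 2 := by
  rw [decayRate, abs_of_nonneg (by positivity)]
  linarith [mul_le_mul_of_nonneg_left (freq_sq_le k) hK₀]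

theorem norm_modeIntegrand_le (hK₀ : 0 ≤ K₀) (hK₂ : 0 ≤ K₂) {P t : ℝ} (hP : ∫ y, ‖φ t y‖ ≤ P)
    (k : Fin 2 → ℤ) :
    ‖modeIntegrand K₀ K₁ K₂ c φ φt k t‖ ≤ ‖c k t‖ * (∫ y, ‖φt t y‖) +
      ((K₀ + K₂) * ((freq k ^ 2) ^ 2 * ‖c k t‖) +
        ‖quadratic (detKernel K₁) (fun j => c j t) k‖) * P := by
  have h1 : ‖c k t * testCoeff φt k t‖ ≤ ‖c k t‖ * ∫ y, ‖φt t y‖ := by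
    rw [norm_mul]
    exact mul_le_mul_of_nonneg_left (norm_testCoeff_le φt k t) (norm_nonneg _)
  have h2 : ‖-decayRate K₀ K₂ k • c k t‖ ≤ (K₀ + K₂) * ((freq k ^ 2) ^ 2 * ‖c k t‖) := by
    rw [norm_smul, norm_neg, Real.norm_eq_abs, ← mul_assoc]
    exact mul_le_mul_of_nonneg_right (abs_decayRate_le hK₀ hK₂ k) (norm_nonneg _)
  have h3 := (norm_add_le (-decayRate K₀ K₂ k • c k t)
    (quadratic (detKernel K₁) (fun j => c j t) k)).trans (add_le_add_left h2 _)
  refine (norm_add_le _ _).trans (add_le_add h1 ?_)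
  rw [norm_mul]
  exact mul_le_mul h3 ((norm_testCoeff_le φ k t).trans hP) (norm_nonneg _)
    ((norm_nonneg _).trans h3)

theorem measurable_quadratic (h : IsFourierSolution K₀ K₁ K₂ x a c) (k : Fin 2 → ℤ) :
    Measurable fun t => quadratic (detKernel K₁) (fun j => c j t) k :=
  Measurable.tsum fun j => ((h.measurable j).mul (h.measurable (k - j))).const_smul
    (detKernel K₁ j (k - j))

theorem aestronglyMeasurable_modeIntegrand (h : IsFourierSolution K₀ K₁ K₂ x a c)
    (hφ : MemW11With T φ φt) (k : Fin 2 → ℤ) :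
    AEStronglyMeasurable (modeIntegrand K₀ K₁ K₂ c φ φt k) (timeMeasure T) := by
  have h1 : Measurable fun t => -decayRate K₀ K₂ k • c k t +
      quadratic (detKernel K₁) (fun j => c j t) k :=
    ((h.measurable k).const_smul (-decayRate K₀ K₂ k)).add (h.measurable_quadratic k)
  have h2 := (integrable_testCoeff hφ.2.1 k).aestronglyMeasurable
  have h3 := (integrable_testCoeff hφ.1 k).aestronglyMeasurable
  exact ((h.measurable k).aestronglyMeasurable.mul h2).add (h1.aestronglyMeasurable.mul h3)

theorem hasSum_integral_modeIntegrand (h : IsFourierSolution K₀ K₁ K₂ x a c) (hK₀ : 0 ≤ K₀)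
    (hK₁ : 0 ≤ K₁) (hK₂ : 0 ≤ K₂) (hφ : IsTestFunction T φ φt D) :
    HasSum (fun k => ∫ t, modeIntegrand K₀ K₁ K₂ c φ φt k t ∂timeMeasure T)
      ((∫ z, weakIntegrand K₀ K₁ K₂ (ofCoeff c) (ofCoeffDeriv c) φ φt D z ∂slab T : ℝ) : ℂ) := by
  rw [integral_prod _ (h.integrable_weakIntegrand hK₁ hφ), ← integral_complex_ofReal]
  set P := (∫ x, ‖φ 0 x‖) + ∫ z, ‖φt z.1 z.2‖ ∂slab T
  have hP : 0 ≤ P := add_nonneg (integral_nonneg fun _ => norm_nonneg _)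
    (integral_nonneg fun _ => norm_nonneg _)
  set Q : (Fin 2 → ℤ) → ℝ → ℂ := fun k t => quadratic (detKernel K₁) (fun j => c j t) k
  have hQ : ∀ k, Measurable (Q k) := h.measurable_quadratic
  set Φ : ℝ → ℝ := fun t => ∫ y, ‖φt t y‖
  have hΦ : Integrable Φ (timeMeasure T) := hφ.memW11.2.1.integral_norm_prod_left
  have hΦ0 : ∀ t, 0 ≤ Φ t := fun t => integral_nonneg fun _ => norm_nonneg _
  -- Summed over `k`, this is at most `a Φ + ((K₀ + K₂) F + 2K₁ a F) P` with `F` the `fourthNorm`,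
  -- which is integrable in time.
  set bound : (Fin 2 → ℤ) → ℝ → ℝ := fun k t =>
    ‖c k t‖ * Φ t + ((K₀ + K₂) * ((freq k ^ 2) ^ 2 * ‖c k t‖) + ‖Q k t‖) * P
  have hbs : ∀ t, (Summable fun k => (freq k ^ 2) ^ 2 * ‖c k t‖) →
      HasSum (fun k => bound k t) ((∑' k, ‖c k t‖) * Φ t +
        ((K₀ + K₂) * fourthNorm c t + ∑' k, ‖Q k t‖) * P) := fun t ht =>
    ((h.summable t).hasSum.mul_right _).add (((ht.hasSum.mul_left _).add
      (h.summable_quadratic hK₁ ht).1.hasSum).mul_right P)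
  refine hasSum_integral_of_dominated_convergence bound (fun k => ?_) (fun k => ?_) ?_ ?_
    (h.ae_hasSum_modeIntegrand hK₁ hφ)
  · exact h.aestronglyMeasurable_modeIntegrand hφ.memW11 k
  · filter_upwards [ae_restrict_mem measurableSet_Ioo] with t ht
    exact norm_modeIntegrand_le hK₀ hK₂ (hφ.memW11.integral_norm_le ⟨ht.1.le, ht.2.le⟩) k
  · filter_upwards [h.ae_summable T] with t ht using (hbs t ht).summable
  · have hm : AEStronglyMeasurable (fun t => ∑' k, bound k t) (timeMeasure T) := by
      have h1 : Measurable fun t => ∑' k, ‖c k t‖ := Measurable.tsum fun k => (h.measurable k).norm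
      have h2 : Measurable fun t => ∑' k, ‖Q k t‖ := Measurable.tsum fun k => (hQ k).norm
      refine ((h1.aestronglyMeasurable.mul hΦ.aestronglyMeasurable).add
        ((((h.integrable_fourthNorm T).aestronglyMeasurable.const_mul (K₀ + K₂)).add
          h2.aestronglyMeasurable).mul_const P)).congr ?_
      filter_upwards [h.ae_summable T] with t ht using (hbs t ht).tsum_eq.symm
    refine (((hΦ.const_mul a)).add ((((h.integrable_fourthNorm T).const_mul (K₀ + K₂)).add
      (((h.integrable_fourthNorm T).const_mul a).const_mul (2 * K₁))).mul_const P)).mono' hm ?_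
    filter_upwards [h.ae_summable T] with t ht
    have h1 := (h.summable_quadratic hK₁ ht).2
    have h0 : ∀ k, 0 ≤ bound k t := fun k => by
      have := hΦ0 t
      positivity
    rw [Real.norm_of_nonneg (tsum_nonneg h0), (hbs t ht).tsum_eq]
    exact add_le_add (mul_le_mul_of_nonneg_right (h.tsum_le t) (hΦ0 t))
      (mul_le_mul_of_nonneg_right (add_le_add_right h1 _) hP)

theorem isWeakSolution {u₀ : Torus → ℝ} (h : IsFourierSolution K₀ K₁ K₂ (coeff u₀) a c)
    (hK₀ : 0 ≤ K₀) (hK₁ : 0 ≤ K₁) (hK₂ : 0 ≤ K₂) (hu₀ : MemWiener 0 u₀) (hT : 0 ≤ T) :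
    IsWeakSolution K₀ K₁ K₂ u₀ T (ofCoeff c) := by
  refine ⟨h.memLp_top T, ofCoeffDeriv c, h.memLpSobolevWith T, fun φ φt D hφ => ?_⟩
  have hc0 : ∀ k, c k 0 = coeff u₀ k := fun k => by simpa using h.eq_integral k 0 le_rfl
  -- The datum need only agree almost everywhere with its Fourier series; the continuous
  -- representative is bounded, which gives integrability against `φ(0)`.
  have hu : u₀ =ᵐ[volume] ofCoeff c 0 := by
    have := ae_eq_series_coeff hu₀.1 hu₀.summable
    simp only [← funext hc0] at this
    exact this
  have hφ0 := hφ.memW11.2.2.1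
  have he : (fun y => ofCoeff c 0 y * φ 0 y) =ᵐ[volume] fun y => u₀ y * φ 0 y := by
    filter_upwards [hu] with y hy
    rw [hy]
  have hi : Integrable fun y => ofCoeff c 0 y * φ 0 y :=
    hφ0.bdd_mul (c := a) (h.integrable_ofCoeff 0).aestronglyMeasurable
      (.of_forall (h.norm_ofCoeff_le 0))
  refine ⟨hi.congr he, h.integrable_weakIntegrand hK₁ hφ, ?_⟩
  have s1 := h.hasSum_integral_modeIntegrand hK₀ hK₁ hK₂ hφ
  simp only [h.integral_modeIntegrand hT hφ, ← hc0] at s1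
  -- Parseval at time `0` sums the remaining boundary terms to minus the initial term of the weak
  -- formulation.
  have s2 := (h.hasSum_ofCoeff_mul hφ0).neg.unique s1
  rw [integral_congr_ae he] at s2
  apply Complex.ofReal_injective
  push_cast
  rw [← s2]
  simp

end IsFourierSolution

end HessianFlow

end

theorem theorem2 (K₀ K₁ K₂ : ℝ) (hK₀ : 0 ≤ K₀) (hK₁ : 0 ≤ K₁) (hK₂ : 0 < K₂)
    (u₀ : HessianFlow.Torus → ℝ) (hu₀ : HessianFlow.MemWiener 0 u₀)
    (hmean : ∫ x, u₀ x = 0)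
    (hsmall : 0 < K₂ - 2 * K₁ * (HessianFlow.wienerNorm 0 u₀).toReal) :
    ∃ u : ℝ → HessianFlow.Torus → ℝ,
      (∀ T : ℝ, 0 < T →
        HessianFlow.IsWeakSolution K₀ K₁ K₂ u₀ T u ∧
        HessianFlow.MemLpWiener T ∞ 0 u ∧
        HessianFlow.MemLpWiener T 1 4 u) ∧
      ∀ t : ℝ, 0 ≤ t →
        HessianFlow.MemWiener 0 (u t) ∧
        (HessianFlow.wienerNorm 0 (u t)).toReal ≤
          Real.exp (-(K₂ - 2 * K₁ * (HessianFlow.wienerNorm 0 u₀).toReal) * t) *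
            (HessianFlow.wienerNorm 0 u₀).toReal := by
  obtain ⟨c, h⟩ := HessianFlow.exists_isFourierSolution hK₀ hK₁ hu₀ hmean hsmall
  refine ⟨HessianFlow.ofCoeff c, fun T hT => ⟨h.isWeakSolution hK₀ hK₁ hK₂.le hu₀ hT.le,
    h.memLpWiener_zero T, h.memLpWiener_four T⟩, fun t ht => ⟨h.memWiener_zero t, ?_⟩⟩
  rw [h.toReal_wienerNorm]
  exact h.tsum_le_exp t ht
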